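/- **Setting.** Let $x\in\mathbb R^{n_x}$, $w\in\mathbb R^{n_w}$, $z\in\mathbb R^{n_z}$ be jointly Gaussian random vectors with zero mean and positive definite joint covariance matrix. Write $V_{ab}=\mathbb E\{ab^\top\}$. A sender observes $(x,w,z)$ and draws a message $y\in\mathbb R^{n_y}$ from a conditional probability distribution (Markov kernel) $\gamma(\cdot\mid x,w,z)$; let $\Gamma$ be either the set of all such policies, or the set of those that do not depend on $z$, i.e. $\gamma(\cdot\mid x,w)$. A receiver draws an estimate $\hat x$ of $x$ from a Markov kernel in the set $\Psi$ of kernels from $(y,z)$ to $\mathbb R^{n_x}$, and a malicious agent draws an estimate $\hat w$ of $w$ from a Markov kernel in the set $\Phi$ of kernels from $(y,z)$ to $\mathbb R^{n_w}$. Fix the privacy ratio $\delta\ge 0$. A triple $(\psi^*,\phi^*,\gamma^*)$ with maps $\psi^*:\Gamma\to\Psi$, $\phi^*:\Gamma\to\Phi$ and $\gamma^*\in\Gamma$ is an *equilibrium* if - $\psi^*$ minimizes $\mathbb E\|x-\hat x\|_2^2$ over all maps $\psi:\Gamma\to\Psi$ when the sender uses $\gamma^*$ and the receiver uses $\psi(\gamma^*)$;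 - $\phi^*$ minimizes $\mathbb E\|w-\hat w\|_2^2$ over all maps $\phi:\Gamma\to\Phi$ when the sender uses $\gamma^*$ and the malicious agent uses $\phi(\gamma^*)$; - these two minimal errors are finite, and $\gamma^*$ minimizes $\mathbb E\|x-\hat x\|_2^2-\delta\,\mathbb E\|w-\hat w\|_2^2$ over all $\gamma\in\Gamma$ when the sender, the receiver and the malicious agent use $\gamma$, $\psi^*(\gamma)$ and $\phi^*(\gamma)$. Put $$\Xi=\begin{bmatrix}V_{xx}&V_{xw}\\V_{wx}&V_{ww}\end{bmatrix}-\begin{bmatrix}V_{xz}\\V_{wz}\end{bmatrix}V_{zz}^{-1}\begin{bmatrix}V_{zx}&V_{zw}\end{bmatrix}$$ and consider the quadratic program over $K=[K_x\;K_w]\in\mathbb R^{n_y\times(n_x+n_w)}$ $$\min_K\ \operatorname{tr}\Big(K\,\Xi\begin{bmatrix}-I&0\\0&\delta I\end{bmatrix}\Xi\,K^\top\Big)\quad\text{subject to}\quad K\,\Xi\,K^\top\le I, \tag{QP}$$ where $\le$ is the order of symmetric matrices by positive semidefiniteness of the difference. **Theorem.** For every $\delta\ge0$, (QP) has a minimizer,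 and there are maps $\psi^*:\Gamma\to\Psi$ and $\phi^*:\Gamma\to\Phi$ with the following properties. 1. For every $\gamma\in\Gamma$ under which $\mathbb E\|y\|_2^2<\infty$, the estimates drawn from $\psi^*(\gamma)$ and $\phi^*(\gamma)$ are, with probability one, the linear least-mean-square estimates of $x$ and $w$ from $(y,z)$: $\hat x=A\begin{bmatrix}y\\z\end{bmatrix}$ and $\hat w=B\begin{bmatrix}y\\z\end{bmatrix}$ for matrices with $$A\begin{bmatrix}V_{yy}&V_{yz}\\V_{zy}&V_{zz}\end{bmatrix}=\begin{bmatrix}V_{xy}&V_{xz}\end{bmatrix},\qquad B\begin{bmatrix}V_{yy}&V_{yz}\\V_{zy}&V_{zz}\end{bmatrix}=\begin{bmatrix}V_{wy}&V_{wz}\end{bmatrix};$$ so $A=\begin{bmatrix}V_{xy}&V_{xz}\end{bmatrix}\begin{bmatrix}V_{yy}&V_{yz}\\V_{zy}&V_{zz}\end{bmatrix}^{-1}$ and $B=\begin{bmatrix}V_{wy}&V_{wz}\end{bmatrix}\begin{bmatrix}V_{yy}&V_{yz}\\V_{zy}&V_{zz}\end{bmatrix}^{-1}$ whenever the inverse exists.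 2. Let $K=[K_x\;K_w]$ be any minimizer of (QP), and let $\gamma^*$ be the policy $$y=K_xx+K_ww+v,$$ where $v$ is a Gaussian vector independent of $(x,w,z)$ with mean zero and covariance $V_{vv}=I-K\,\Xi\,K^\top$. Then $(\psi^*,\phi^*,\gamma^*)$ is an equilibrium. Under $\gamma^*$, $\mathbb E\|y\|_2^2<\infty$ and $\begin{bmatrix}V_{yy}&V_{yz}\\V_{zy}&V_{zz}\end{bmatrix}$ is invertible, so that $\hat x$ and $\hat w$ are given with probability one by the formulas with the inverse. 3. If $n_x,n_y\ge1$, each of these equilibria is informative: the receiver's error $\mathbb E\|x-\hat x\|_2^2$ is strictly smaller than that of every (possibly randomized) estimator of $x$ based on $z$ alone. 4. For every $\kappa\in\mathbb R^{n_y\times n_y}$ with $\det\kappa\ne0$, $(\psi^*,\phi^*,\kappa\gamma^*)$ is again an equilibrium, where $\kappa\gamma^*$ sends $\kappa y$ whenever $\gamma^*$ sends $y$. -/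

import Mathlib

open MeasureTheory ProbabilityTheory
open scoped ENNReal

namespace PrivacyGame

noncomputable section

/-- Euclidean space `ℝⁿ`. -/
abbrev Vec (n : ℕ) : Type := EuclideanSpace ℝ (Fin n)

/-- The realizations of the triple `(x, w, z)`: state, private information, side information. -/
abbrev State (nx nw nz : ℕ) : Type := Vec nx × Vec nw × Vec nz

/-- A randomized policy: a conditional probability distribution on the actions `B` given the
observation `A`. -/
structure Policy (A B : Type*) [MeasurableSpace A] [MeasurableSpace B] where
  kernel : Kernel A B
  isMarkov : IsMarkovKernel kernel

attribute [instance] Policy.isMarkov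

/-- Sender policies `γ(dy | x, w, z)`. -/
abbrev Sender (nx nw nz ny : ℕ) : Type := Policy (State nx nw nz) (Vec ny)

/-- Estimators `η(de | y, z)` with values in `ℝⁿ`; the receiver has `n = nx`, the malicious agent
has `n = nw`. -/
abbrev Estimator (ny nz n : ℕ) : Type := Policy (Vec ny × Vec nz) (Vec n)

variable {nx nw nz ny n : ℕ}

/-- The sender policies of the form `γ(dy | x, w)`. -/
def withoutSideInformation (nx nw nz ny : ℕ) : Set (Sender nx nw nz ny) :=
  {γ | ∃ γ₀ : Policy (Vec nx × Vec nw) (Vec ny), ∀ x w z, γ.kernel (x, w, z) = γ₀.kernel (x, w)}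

/-- The expected squared error `E‖t - e‖²`, where `t` is the target (`x` or `w`), `(x, w, z)` has
law `μ`, the message `y` is drawn from `γ(· | x, w, z)`, and `e` is drawn from `η(· | y, z)`. -/
def estimationCost (μ : Measure (State nx nw nz)) (target : State nx nw nz → Vec n)
    (γ : Sender nx nw nz ny) (η : Estimator ny nz n) : ℝ≥0∞ :=
  ∫⁻ s, ∫⁻ y, ∫⁻ e, ‖target s - e‖ₑ ^ 2 ∂(η.kernel (y, s.2.2)) ∂(γ.kernel s) ∂μ

def receiverCost (μ : Measure (State nx nw nz)) (γ : Sender nx nw nz ny)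
    (η : Estimator ny nz nx) : ℝ≥0∞ :=
  estimationCost μ (fun s => s.1) γ η

def maliciousCost (μ : Measure (State nx nw nz)) (γ : Sender nx nw nz ny)
    (η : Estimator ny nz nw) : ℝ≥0∞ :=
  estimationCost μ (fun s => s.2.1) γ η

/-- The sender's cost `E‖x - x̂‖² - δ E‖w - ŵ‖²`. The indeterminate case `⊤ - ⊤` has the value `⊥`,
so that a deviation with an indeterminate cost would count as profitable. -/
def senderCost (μ : Measure (State nx nw nz)) (δ : ℝ) (γ : Sender nx nw nz ny)
    (η : Estimator ny nz nx) (θ : Estimator ny nz nw) : EReal :=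
  (receiverCost μ γ η : EReal) - (δ : EReal) * (maliciousCost μ γ θ : EReal)

/-- Equilibrium of the privacy game with privacy ratio `δ` in which the sender chooses from `Γ`.
The receiver and the malicious agent choose maps from sender policies to estimators. Only the
values of `ψ` and `φ` on `Γ` matter. -/
structure IsEquilibrium (μ : Measure (State nx nw nz)) (δ : ℝ) (Γ : Set (Sender nx nw nz ny))
    (ψ : Sender nx nw nz ny → Estimator ny nz nx) (φ : Sender nx nw nz ny → Estimator ny nz nw)
    (γ : Sender nx nw nz ny) : Prop where
  mem : γ ∈ Γ
  receiverCost_ne_top : receiverCost μ γ (ψ γ) ≠ ⊤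
  maliciousCost_ne_top : maliciousCost μ γ (φ γ) ≠ ⊤
  receiver_optimal : ∀ ψ' : Sender nx nw nz ny → Estimator ny nz nx,
    receiverCost μ γ (ψ γ) ≤ receiverCost μ γ (ψ' γ)
  malicious_optimal : ∀ φ' : Sender nx nw nz ny → Estimator ny nz nw,
    maliciousCost μ γ (φ γ) ≤ maliciousCost μ γ (φ' γ)
  sender_optimal : ∀ γ' ∈ Γ,
    senderCost μ δ γ (ψ γ) (φ γ) ≤ senderCost μ δ γ' (ψ γ') (φ γ')

/-- The message carries information about the state: with it, the receiver's error is strictly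
smaller than that of every estimator of `x` that is based on `z` alone. -/
def IsInformative (μ : Measure (State nx nw nz)) (ψ : Sender nx nw nz ny → Estimator ny nz nx)
    (γ : Sender nx nw nz ny) : Prop :=
  ∀ η : Policy (Vec nz) (Vec nx),
    receiverCost μ γ (ψ γ) < ∫⁻ s, ∫⁻ e, ‖s.1 - e‖ₑ ^ 2 ∂(η.kernel s.2.2) ∂μ

/-- The matrix `V_{ab} = E[a bᵀ]`. -/
def secondMoment {Ω ι κ : Type*} [MeasurableSpace Ω] (P : Measure Ω) (a : Ω → ι → ℝ)
    (b : Ω → κ → ℝ) : Matrix ι κ ℝ :=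
  Matrix.of fun i j => ∫ ω, a ω i * b ω j ∂P

/-- The stacked vector `(x, w)`. -/
def vecXW (s : State nx nw nz) : Fin nx ⊕ Fin nw → ℝ := Sum.elim s.1 s.2.1

/-- The side information `z` as a coordinate vector. -/
def vecZ (s : State nx nw nz) : Fin nz → ℝ := s.2.2

/-- The stacked vector `(x, w, z)`. -/
def vecXWZ (s : State nx nw nz) : (Fin nx ⊕ Fin nw) ⊕ Fin nz → ℝ := Sum.elim (vecXW s) (vecZ s)

/-- The stacked vector `(y, z)`. -/
def vecYZ (y : Vec ny) (z : Vec nz) : Fin ny ⊕ Fin nz → ℝ := Sum.elim y z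

/-- The joint law of `((x, w, z), y)` under the sender policy `γ`. -/
def jointLaw (μ : Measure (State nx nw nz)) (γ : Sender nx nw nz ny) :
    Measure (State nx nw nz × Vec ny) :=
  μ ⊗ₘ γ.kernel

/-- `E‖y‖² < ∞` under the sender policy `γ`. -/
def HasFiniteSecondMoment (μ : Measure (State nx nw nz)) (γ : Sender nx nw nz ny) : Prop :=
  ∫⁻ p, ‖p.2‖ₑ ^ 2 ∂(jointLaw μ γ) < ⊤

/-- The block matrix `[[V_yy, V_yz], [V_zy, V_zz]]`. -/
def obsMoment (μ : Measure (State nx nw nz)) (γ : Sender nx nw nz ny) :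
    Matrix (Fin ny ⊕ Fin nz) (Fin ny ⊕ Fin nz) ℝ :=
  secondMoment (jointLaw μ γ) (fun p => vecYZ p.2 p.1.2.2) (fun p => vecYZ p.2 p.1.2.2)

/-- The block matrix `[V_ty, V_tz]` for the target `t` (`x` or `w`). -/
def crossMoment (μ : Measure (State nx nw nz)) (target : State nx nw nz → Vec n)
    (γ : Sender nx nw nz ny) : Matrix (Fin n) (Fin ny ⊕ Fin nz) ℝ :=
  secondMoment (jointLaw μ γ) (fun p => target p.1) (fun p => vecYZ p.2 p.1.2.2)

/-- Under the sender policy `γ`, the estimate drawn from `η(· | y, z)` is `A (y, z)` with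
probability one. -/
def UsesGain (μ : Measure (State nx nw nz)) (γ : Sender nx nw nz ny) (η : Estimator ny nz n)
    (A : Matrix (Fin n) (Fin ny ⊕ Fin nz) ℝ) : Prop :=
  ∀ᵐ p ∂(jointLaw μ γ), ∀ᵐ e ∂(η.kernel (p.2, p.1.2.2)),
    e = WithLp.toLp 2 (A.mulVec (vecYZ p.2 p.1.2.2))

/-- Under the sender policy `γ`, the estimator `η` is the linear least-mean-square estimator of the
target from `(y, z)`: with probability one the estimate is `A (y, z)`, where `A` satisfies the
normal equations, and `A = [V_ty, V_tz] [[V_yy, V_yz], [V_zy, V_zz]]⁻¹` if the inverse exists. -/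
def IsLinearLMS (μ : Measure (State nx nw nz)) (target : State nx nw nz → Vec n)
    (γ : Sender nx nw nz ny) (η : Estimator ny nz n) : Prop :=
  ∃ A : Matrix (Fin n) (Fin ny ⊕ Fin nz) ℝ,
    A * obsMoment μ γ = crossMoment μ target γ ∧
    (IsUnit (obsMoment μ γ).det → A = crossMoment μ target γ * (obsMoment μ γ)⁻¹) ∧
    UsesGain μ γ η A

/-- The Schur complement `Ξ = V_{(x,w)(x,w)} - V_{(x,w)z} V_zz⁻¹ V_{z(x,w)}`. -/
def schurCov (μ : Measure (State nx nw nz)) : Matrix (Fin nx ⊕ Fin nw) (Fin nx ⊕ Fin nw) ℝ :=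
  secondMoment μ vecXW vecXW -
    secondMoment μ vecXW vecZ * (secondMoment μ vecZ vecZ)⁻¹ * secondMoment μ vecZ vecXW

/-- The gains `K = [K_x, K_w]` with `K Ξ Kᵀ ≤ I` in the Loewner order. -/
def feasible (μ : Measure (State nx nw nz)) (ny : ℕ) :
    Set (Matrix (Fin ny) (Fin nx ⊕ Fin nw) ℝ) :=
  {K | (1 - K * schurCov μ * K.transpose).PosSemidef}

/-- The objective `tr(K Ξ diag(-I, δ I) Ξ Kᵀ)`. -/
def objective (μ : Measure (State nx nw nz)) (δ : ℝ)
    (K : Matrix (Fin ny) (Fin nx ⊕ Fin nw) ℝ) : ℝ :=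
  (K * schurCov μ *
    Matrix.fromBlocks (-(1 : Matrix (Fin nx) (Fin nx) ℝ)) 0 0 (δ • (1 : Matrix (Fin nw) (Fin nw) ℝ)) *
    schurCov μ * K.transpose).trace

/-- The optimal solutions of the quadratic program. -/
def minimizers (μ : Measure (State nx nw nz)) (δ : ℝ) (ny : ℕ) :
    Set (Matrix (Fin ny) (Fin nx ⊕ Fin nw) ℝ) :=
  {K | K ∈ feasible μ ny ∧ ∀ K' ∈ feasible μ ny, objective μ δ K ≤ objective μ δ K'}

/-- The sender policy `y = K_x x + K_w w + v`, where `v` is independent of `(x, w, z)` with the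
centred Gaussian law of covariance `I - K Ξ Kᵀ`. -/
def gaussianSender (μ : Measure (State nx nw nz)) (K : Matrix (Fin ny) (Fin nx ⊕ Fin nw) ℝ) :
    Sender nx nw nz ny where
  kernel :=
    (Kernel.id ×ₖ Kernel.const (State nx nw nz)
        (multivariateGaussian (0 : Vec ny) (1 - K * schurCov μ * K.transpose))).map
      fun p => K.toCols₁.toEuclideanLin p.1.1 + K.toCols₂.toEuclideanLin p.1.2.1 + p.2
  isMarkov := by
    refine Kernel.IsMarkovKernel.map _ ?_
    have h₁ : Continuous K.toCols₁.toEuclideanLin := LinearMap.continuous_of_finiteDimensional _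
    have h₂ : Continuous K.toCols₂.toEuclideanLin := LinearMap.continuous_of_finiteDimensional _
    fun_prop

/-- The policy `κγ`, which sends `κ y` whenever `γ` sends `y`. -/
def Policy.scale {A : Type*} [MeasurableSpace A] (κ : Matrix (Fin ny) (Fin ny) ℝ)
    (γ : Policy A (Vec ny)) : Policy A (Vec ny) where
  kernel := γ.kernel.map κ.toEuclideanLin
  isMarkov := by
    refine Kernel.IsMarkovKernel.map _ ?_
    have h : Continuous κ.toEuclideanLin := LinearMap.continuous_of_finiteDimensional _
    fun_prop

end

end PrivacyGame

open PrivacyGame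

/-!
Under a policy that makes `(x, w, z, y)` Gaussian, the residual of the linear least-mean-square
estimate is independent of `(y, z)`, so no estimator from `(y, z)`, randomized or not, has a
smaller error. For an arbitrary policy with `E‖y‖² < ∞` the normal equations show that the linear
estimates of `(x, w)` have error covariance `Ξ - G M Gᵀ`, where `M` is the partial covariance of
`y` given `z` and `G` is the gain on `y`. As `G M Gᵀ ≤ Ξ` has rank at most `n_y`, it is equal to
`Ξ Kᵀ K Ξ` for some `K` with `K Ξ Kᵀ ≤ I`, and the sender's cost is a constant plus the objective
of (QP) at `K`. A policy with `E‖y‖² = ∞` is answered by the best linear estimators that ignore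
`y`, which is the case `K = 0`. Conversely every feasible `K` is attained by
`y = K_x x + K_w w + v`, for which `M = I` and `G = Ξ Kᵀ`, and an invertible `κ` changes neither
the estimates nor the costs. If `n_x, n_y ≥ 1`, revealing the part of one coordinate of `x` that is
uncorrelated with all other coordinates given `z` makes the objective negative, so a minimizer
strictly reduces the error of the receiver.
-/

namespace PrivacyGame

section MatrixInequalities

open Matrix
open scoped MatrixOrder

variable {l m n : Type*}

lemma exists_mul_eq_of_mulVec_eq_zero [Fintype m] [Fintype n] {A : Matrix l n ℝ} {B : Matrix m n ℝ}
    (h : ∀ v, B *ᵥ v = 0 → A *ᵥ v = 0) : ∃ C : Matrix l m ℝ, C * B = A := by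
  classical
  have hrow (i : l) : ∃ c : m → ℝ, c ᵥ* B = A i := by
    have hker : ⨅ k, LinearMap.ker (dotProductBilin ℝ ℝ (B k)) ≤
        LinearMap.ker (dotProductBilin ℝ ℝ (A i)) := fun v hv =>
      congrFun (h v (funext fun k => (Submodule.mem_iInf _).mp hv k)) i
    obtain ⟨c, hc⟩ :=
      (Submodule.mem_span_range_iff_exists_fun ℝ).mp (mem_span_of_iInf_ker_le_ker hker)
    refine ⟨c, funext fun j => ?_⟩
    have hj := LinearMap.congr_fun hc (Pi.single j 1)
    simp only [LinearMap.sum_apply, LinearMap.smul_apply, dotProductBilin_apply_apply,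
      dotProduct_single_one, smul_eq_mul] at hj
    exact hj
  choose C hC using hrow
  exact ⟨C, funext hC⟩

lemma mulVec_sumElim_eq_add [Fintype m] [Fintype n] (G : Matrix l (m ⊕ n) ℝ) (u : m → ℝ)
    (v : n → ℝ) :
    G *ᵥ Sum.elim u v = G.toCols₁ *ᵥ u + G.toCols₂ *ᵥ v := by
  conv_lhs => rw [← fromCols_toCols G]
  exact fromCols_mulVec_sumElim _ _ _ _

lemma exists_transpose_mul_self_eq [Fintype m] {S : Matrix m m ℝ} (hS : S.PosSemidef) :
    ∃ B : Matrix m m ℝ, Bᵀ * B = S := by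
  classical
  obtain ⟨B, hB⟩ := CStarAlgebra.nonneg_iff_eq_star_mul_self.mp hS.nonneg
  exact ⟨B, by rw [hB, star_eq_conjTranspose, conjTranspose_eq_transpose_of_trivial]⟩

lemma posDef_schurComplement [Finite m] [Fintype n] [DecidableEq n] {A : Matrix m m ℝ}
    {B : Matrix m n ℝ} {D : Matrix n n ℝ} (h : (fromBlocks A B Bᵀ D).PosDef) :
    (A - B * D⁻¹ * Bᵀ).PosDef := by
  classical
  have := Fintype.ofFinite m
  have hD : D.PosDef := h.submatrix (e := (Sum.inr : n → m ⊕ n)) Sum.inr_injective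
  have : Invertible D := hD.isUnit.invertible
  rw [← conjTranspose_eq_transpose_of_trivial] at h ⊢
  have hS : (A - B * D⁻¹ * Bᴴ).PosSemidef := (PosDef.fromBlocks₂₂ A B hD).mp h.posSemidef
  rw [hS.posDef_iff_isUnit, isUnit_iff_isUnit_det]
  have hdet := (isUnit_iff_isUnit_det _).mp h.isUnit
  rw [det_fromBlocks₂₂, invOf_eq_nonsing_inv] at hdet
  exact isUnit_of_mul_isUnit_right hdet

lemma isUnit_det_of_posDef [Fintype m] [DecidableEq m] {X : Matrix m m ℝ} (hX : X.PosDef) :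
    IsUnit X.det :=
  (isUnit_iff_isUnit_det _).mp hX.isUnit

lemma transpose_inv_of_posDef [Fintype m] [DecidableEq m] {X : Matrix m m ℝ} (hX : X.PosDef) :
    (X⁻¹)ᵀ = X⁻¹ := by
  simpa only [IsHermitian, conjTranspose_eq_transpose_of_trivial] using hX.inv.isHermitian

-- With `S = BᵀB` and `K = B Gᵀ X⁻¹`, both `X - G S Gᵀ ≥ 0` and `1 - K X Kᵀ ≥ 0` say that the block
-- matrix with rows `X, G Bᵀ` and `B Gᵀ, 1` is positive semidefinite.
lemma exists_gain_of_reduction [Fintype m] [Fintype n] [DecidableEq n] {X : Matrix m m ℝ}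
    (hX : X.PosDef) {S : Matrix n n ℝ} (hS : S.PosSemidef) {G : Matrix m n ℝ}
    (h : (X - G * S * Gᵀ).PosSemidef) :
    ∃ K : Matrix n m ℝ, (1 - K * X * Kᵀ).PosSemidef ∧ X * Kᵀ * K * X = G * S * Gᵀ := by
  classical
  obtain ⟨B, rfl⟩ := exists_transpose_mul_self_eq hS
  have hu : IsUnit X.det := isUnit_det_of_posDef hX
  have hXi : (X⁻¹)ᵀ = X⁻¹ := transpose_inv_of_posDef hX
  have : Invertible X := hX.isUnit.invertible
  have : Invertible (1 : Matrix n n ℝ) := invertibleOne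
  refine ⟨B * Gᵀ * X⁻¹, ?_, ?_⟩
  · have hblock : (fromBlocks X (G * Bᵀ) (G * Bᵀ)ᴴ (1 : Matrix n n ℝ)).PosSemidef := by
      rw [PosDef.fromBlocks₂₂ _ _ PosDef.one]
      simpa [Matrix.mul_assoc] using h
    rw [PosDef.fromBlocks₁₁ _ _ hX] at hblock
    have hK : B * Gᵀ * X⁻¹ * X * (B * Gᵀ * X⁻¹)ᵀ = (G * Bᵀ)ᴴ * X⁻¹ * (G * Bᵀ) := by
      simp only [transpose_mul, transpose_transpose, hXi, conjTranspose_eq_transpose_of_trivial,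
        Matrix.mul_assoc, nonsing_inv_mul_cancel_left _ _ hu]
    rwa [hK]
  · simp only [transpose_mul, transpose_transpose, hXi, Matrix.mul_assoc,
      nonsing_inv_mul _ hu, mul_nonsing_inv_cancel_left _ _ hu, Matrix.mul_one]

-- `(X⁻¹ i i)⁻¹` is the conditional variance of coordinate `i` given the other coordinates, and the
-- gain transmits the normalized residual of coordinate `i`.
lemma exists_gain_reduction_eq_single [Fintype m] [DecidableEq m] [Fintype n] [DecidableEq n]
    {X : Matrix m m ℝ} (hX : X.PosDef) (i : m) (j : n) :
    ∃ K : Matrix n m ℝ, (1 - K * X * Kᵀ).PosSemidef ∧ X * Kᵀ * K * X = single i i (X⁻¹ i i)⁻¹ := by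
  have hu : IsUnit X.det := isUnit_det_of_posDef hX
  have hXi : (X⁻¹)ᵀ = X⁻¹ := transpose_inv_of_posDef hX
  have hpos : 0 < X⁻¹ i i := hX.inv.diag_pos
  set c : ℝ := √(X⁻¹ i i)⁻¹
  have hc : c * c = (X⁻¹ i i)⁻¹ := Real.mul_self_sqrt (inv_nonneg.mpr hpos.le)
  refine ⟨single j i c * X⁻¹, ?_, ?_⟩
  · have hK : single j i c * X⁻¹ * X * (single j i c * X⁻¹)ᵀ = single j j 1 := by
      rw [transpose_mul, hXi, transpose_single, nonsing_inv_mul_cancel_right _ _ hu,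
        ← Matrix.mul_assoc, single_mul_mul_single, mul_right_comm, hc, inv_mul_cancel₀ hpos.ne']
    rw [hK, ← diagonal_one, ← diagonal_single, diagonal_sub, posSemidef_diagonal_iff]
    intro k
    by_cases hk : k = j <;> simp [hk]
  · simp only [transpose_mul, hXi, transpose_single, Matrix.mul_assoc, nonsing_inv_mul _ hu,
      mul_nonsing_inv_cancel_left _ _ hu, Matrix.mul_one, single_mul_single_same, hc]

lemma isClosed_setOf_posSemidef_one_sub [Fintype m] [Finite n] [DecidableEq n] :
    IsClosed {U : Matrix n m ℝ | (1 - U * Uᵀ).PosSemidef} := by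
  have := Fintype.ofFinite n
  have heq : {U : Matrix n m ℝ | (1 - U * Uᵀ).PosSemidef} =
      ⋂ v : n → ℝ, {U | 0 ≤ v ⬝ᵥ (1 - U * Uᵀ) *ᵥ v} := by
    ext U
    simp only [Set.mem_ofPred_eq, Set.mem_iInter]
    refine ⟨fun h v => by simpa using h.dotProduct_mulVec_nonneg v, fun h => ?_⟩
    refine PosSemidef.of_dotProduct_mulVec_nonneg ?_ fun v => by simpa using h v
    simp [IsHermitian, conjTranspose_eq_transpose_of_trivial]
  rw [heq]
  exact isClosed_iInter fun v => isClosed_le continuous_const (by fun_prop)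

lemma abs_apply_le_one_of_posSemidef [Fintype m] [DecidableEq n] {U : Matrix n m ℝ}
    (hU : (1 - U * Uᵀ).PosSemidef) (i : n) (j : m) : |U i j| ≤ 1 := by
  have hdiag := hU.diag_nonneg (i := i)
  rw [Matrix.sub_apply, one_apply_eq, mul_apply] at hdiag
  have hle : U i j * Uᵀ j i ≤ ∑ k, U i k * Uᵀ k i :=
    Finset.single_le_sum (f := fun k => U i k * Uᵀ k i) (fun k _ => mul_self_nonneg _)
      (Finset.mem_univ j)
  rw [transpose_apply] at hle
  rw [← sq_le_one_iff_abs_le_one]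
  linarith [pow_two (U i j)]

lemma isCompact_setOf_posSemidef_one_sub [Fintype m] [Finite n] [DecidableEq n] :
    IsCompact {U : Matrix n m ℝ | (1 - U * Uᵀ).PosSemidef} := by
  have hbox : IsCompact (Set.univ.pi fun _ : n => Set.univ.pi fun _ : m => Set.Icc (-1 : ℝ) 1) :=
    isCompact_univ_pi fun _ => isCompact_univ_pi fun _ => isCompact_Icc
  exact hbox.of_isClosed_subset isClosed_setOf_posSemidef_one_sub
    fun _ hU i _ j _ => abs_le.mp (abs_apply_le_one_of_posSemidef hU i j)

-- The substitution `U = K Bᵀ` with `X = BᵀB` turns the constraint into the compact `U Uᵀ ≤ 1`.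
lemma exists_forall_trace_le [Fintype m] [Fintype n] [DecidableEq n] {X : Matrix m m ℝ}
    (hX : X.PosDef) (W : Matrix m m ℝ) :
    ∃ K : Matrix n m ℝ, (1 - K * X * Kᵀ).PosSemidef ∧
      ∀ K' : Matrix n m ℝ, (1 - K' * X * K'ᵀ).PosSemidef →
        (K * W * Kᵀ).trace ≤ (K' * W * K'ᵀ).trace := by
  classical
  obtain ⟨B, hB⟩ := exists_transpose_mul_self_eq hX.posSemidef
  have hu : IsUnit Bᵀ.det := by
    have hdet : IsUnit (Bᵀ * B).det := by rw [hB]; exact isUnit_det_of_posDef hX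
    rw [det_mul] at hdet
    exact isUnit_of_mul_isUnit_left hdet
  have hsubst (K : Matrix n m ℝ) : K * X * Kᵀ = K * Bᵀ * (K * Bᵀ)ᵀ := by
    simp only [← hB, transpose_mul, transpose_transpose, Matrix.mul_assoc]
  obtain ⟨U, hU, hmin⟩ := (isCompact_setOf_posSemidef_one_sub (m := m) (n := n)).exists_isMinOn
    ⟨0, by simpa using PosSemidef.one⟩
    (f := fun U => (U * (Bᵀ)⁻¹ * W * (U * (Bᵀ)⁻¹)ᵀ).trace) (by fun_prop)
  refine ⟨U * (Bᵀ)⁻¹, ?_, fun K' hK' => ?_⟩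
  · rw [hsubst, nonsing_inv_mul_cancel_right _ _ hu]
    exact hU
  · rw [hsubst] at hK'
    have hle : (U * (Bᵀ)⁻¹ * W * (U * (Bᵀ)⁻¹)ᵀ).trace ≤
        (K' * Bᵀ * (Bᵀ)⁻¹ * W * (K' * Bᵀ * (Bᵀ)⁻¹)ᵀ).trace := hmin hK'
    simpa only [mul_nonsing_inv_cancel_right _ _ hu] using hle

end MatrixInequalities

section SecondMoment

open Matrix

variable {Ω Ω' ι ι' κ κ' τ : Type*} [MeasurableSpace Ω] [MeasurableSpace Ω'] {P : Measure Ω}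

lemma secondMoment_transpose (a : Ω → ι → ℝ) (b : Ω → κ → ℝ) :
    (secondMoment P a b)ᵀ = secondMoment P b a := by
  ext i j
  simp [secondMoment, mul_comm]

lemma secondMoment_map {f : Ω → Ω'} (hf : Measurable f) {a : Ω' → ι → ℝ} {b : Ω' → κ → ℝ}
    (ha : Measurable a) (hb : Measurable b) :
    secondMoment (P.map f) a b = secondMoment P (fun ω => a (f ω)) (fun ω => b (f ω)) := by
  ext i j
  exact integral_map hf.aemeasurable
    (((measurable_pi_apply i).comp ha).mul ((measurable_pi_apply j).comp hb)).aestronglyMeasurable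

lemma secondMoment_sumElim_right (a : Ω → ι → ℝ) (b : Ω → κ → ℝ) (b' : Ω → κ' → ℝ) :
    secondMoment P a (fun ω => Sum.elim (b ω) (b' ω)) =
      fromCols (secondMoment P a b) (secondMoment P a b') := by
  ext i (j | j) <;> rfl

lemma secondMoment_sumElim (a : Ω → ι → ℝ) (a' : Ω → ι' → ℝ) (b : Ω → κ → ℝ) (b' : Ω → κ' → ℝ) :
    secondMoment P (fun ω => Sum.elim (a ω) (a' ω)) (fun ω => Sum.elim (b ω) (b' ω)) =
      fromBlocks (secondMoment P a b) (secondMoment P a b')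
        (secondMoment P a' b) (secondMoment P a' b') := by
  ext (i | i) (j | j) <;> rfl

variable [Fintype ι] [Fintype κ]

lemma memLp_sumElim [Fintype κ'] {p : ℝ≥0∞} {b : Ω → κ → ℝ} {b' : Ω → κ' → ℝ} (hb : MemLp b p P)
    (hb' : MemLp b' p P) : MemLp (fun ω => Sum.elim (b ω) (b' ω)) p P :=
  MemLp.of_eval (Sum.rec hb.eval hb'.eval)

lemma memLp_mulVec [Fintype τ] {p : ℝ≥0∞} (A : Matrix τ ι ℝ) {a : Ω → ι → ℝ} (ha : MemLp a p P) :
    MemLp (fun ω => A *ᵥ a ω) p P :=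
  MemLp.of_eval fun t => memLp_finsetSum _ fun i _ => (ha.eval i).const_mul (A t i)

lemma integrable_mul_of_memLp {a : Ω → ι → ℝ} {b : Ω → κ → ℝ} (ha : MemLp a 2 P)
    (hb : MemLp b 2 P) (i : ι) (j : κ) : Integrable (fun ω => a ω i * b ω j) P :=
  (ha.eval i).integrable_mul (hb.eval j)

lemma secondMoment_add_left {a a' : Ω → ι → ℝ} {b : Ω → κ → ℝ} (ha : MemLp a 2 P)
    (ha' : MemLp a' 2 P) (hb : MemLp b 2 P) :
    secondMoment P (fun ω => a ω + a' ω) b = secondMoment P a b + secondMoment P a' b := by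
  ext i j
  simp only [secondMoment, of_apply, Matrix.add_apply, Pi.add_apply, add_mul]
  exact integral_add (integrable_mul_of_memLp ha hb i j) (integrable_mul_of_memLp ha' hb i j)

lemma secondMoment_mulVec_left (A : Matrix τ ι ℝ) {a : Ω → ι → ℝ} {b : Ω → κ → ℝ}
    (ha : MemLp a 2 P) (hb : MemLp b 2 P) :
    secondMoment P (fun ω => A *ᵥ a ω) b = A * secondMoment P a b := by
  ext t j
  simp only [secondMoment, of_apply, mul_apply, mulVec, dotProduct, Finset.sum_mul, mul_assoc]
  rw [integral_finsetSum _ fun i _ => (integrable_mul_of_memLp ha hb i j).const_mul _]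
  simp only [integral_const_mul]

lemma secondMoment_sub_left {a a' : Ω → ι → ℝ} {b : Ω → κ → ℝ} (ha : MemLp a 2 P)
    (ha' : MemLp a' 2 P) (hb : MemLp b 2 P) :
    secondMoment P (fun ω => a ω - a' ω) b = secondMoment P a b - secondMoment P a' b := by
  ext i j
  simp only [secondMoment, of_apply, Matrix.sub_apply, Pi.sub_apply, sub_mul]
  exact integral_sub (integrable_mul_of_memLp ha hb i j) (integrable_mul_of_memLp ha' hb i j)

lemma dotProduct_secondMoment_mulVec {a : Ω → ι → ℝ} {b : Ω → κ → ℝ} (ha : MemLp a 2 P)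
    (hb : MemLp b 2 P) (u : ι → ℝ) (v : κ → ℝ) :
    u ⬝ᵥ secondMoment P a b *ᵥ v = ∫ ω, (u ⬝ᵥ a ω) * (v ⬝ᵥ b ω) ∂P := by
  have hint (i : ι) (j : κ) : Integrable (fun ω => u i * a ω i * (v j * b ω j)) P := by
    simpa only [Pi.smul_apply, smul_eq_mul] using
      integrable_mul_of_memLp (MemLp.of_eval fun i => (ha.eval i).const_mul (u i))
        (MemLp.of_eval fun j => (hb.eval j).const_mul (v j)) i j
  simp only [dotProduct, Finset.sum_mul_sum]
  rw [integral_finsetSum _ fun i _ => integrable_finsetSum _ fun j _ => hint i j]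
  refine Finset.sum_congr rfl fun i _ => ?_
  rw [integral_finsetSum _ fun j _ => hint i j, mulVec, dotProduct, Finset.mul_sum]
  refine Finset.sum_congr rfl fun j _ => ?_
  rw [secondMoment, of_apply, ← integral_mul_const, ← integral_const_mul]
  exact integral_congr_ae (.of_forall fun ω => by ring)

lemma posSemidef_secondMoment {a : Ω → ι → ℝ} (ha : MemLp a 2 P) :
    (secondMoment P a a).PosSemidef := by
  refine PosSemidef.of_dotProduct_mulVec_nonneg ?_ fun v => ?_
  · rw [IsHermitian, conjTranspose_eq_transpose_of_trivial, secondMoment_transpose]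
  · rw [star_trivial, dotProduct_secondMoment_mulVec ha ha]
    exact integral_nonneg fun ω => mul_self_nonneg _

lemma secondMoment_mulVec_eq_zero {a : Ω → ι → ℝ} {b : Ω → κ → ℝ} (ha : MemLp a 2 P)
    (hb : MemLp b 2 P) {v : κ → ℝ} (hv : secondMoment P b b *ᵥ v = 0) :
    secondMoment P a b *ᵥ v = 0 := by
  have hsq : ∫ ω, (v ⬝ᵥ b ω) * (v ⬝ᵥ b ω) ∂P = 0 := by
    rw [← dotProduct_secondMoment_mulVec hb hb, hv, dotProduct_zero]
  have hvb : MemLp (fun ω => v ⬝ᵥ b ω) 2 P :=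
    memLp_finsetSum _ fun j _ => (hb.eval j).const_mul (v j)
  rw [integral_eq_zero_iff_of_nonneg (fun ω => mul_self_nonneg _) (hvb.integrable_mul hvb)] at hsq
  refine dotProduct_eq_zero _ fun u => ?_
  rw [dotProduct_comm, dotProduct_secondMoment_mulVec ha hb]
  refine integral_eq_zero_of_ae ?_
  filter_upwards [hsq] with ω hω
  simp [mul_self_eq_zero.mp hω]

lemma exists_mul_secondMoment_eq {a : Ω → ι → ℝ} {b : Ω → κ → ℝ} (ha : MemLp a 2 P)
    (hb : MemLp b 2 P) : ∃ A : Matrix ι κ ℝ, A * secondMoment P b b = secondMoment P a b :=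
  exists_mul_eq_of_mulVec_eq_zero fun _ => secondMoment_mulVec_eq_zero ha hb

lemma secondMoment_residual_left {a : Ω → ι → ℝ} {b : Ω → κ → ℝ} (ha : MemLp a 2 P)
    (hb : MemLp b 2 P) {A : Matrix ι κ ℝ} (hA : A * secondMoment P b b = secondMoment P a b) :
    secondMoment P (fun ω => a ω - A *ᵥ b ω) b = 0 := by
  rw [secondMoment_sub_left ha (memLp_mulVec A hb) hb, secondMoment_mulVec_left A hb hb, hA,
    sub_self]

lemma secondMoment_residual {a : Ω → ι → ℝ} {b : Ω → κ → ℝ} (ha : MemLp a 2 P)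
    (hb : MemLp b 2 P) {A : Matrix ι κ ℝ} (hA : A * secondMoment P b b = secondMoment P a b) :
    secondMoment P (fun ω => a ω - A *ᵥ b ω) (fun ω => a ω - A *ᵥ b ω) =
      secondMoment P a a - secondMoment P a b * Aᵀ := by
  have he : MemLp (fun ω => a ω - A *ᵥ b ω) 2 P := ha.sub (memLp_mulVec A hb)
  have hbe : secondMoment P b (fun ω => a ω - A *ᵥ b ω) = 0 := by
    rw [← secondMoment_transpose, secondMoment_residual_left ha hb hA, transpose_zero]
  have hae : secondMoment P a (fun ω => a ω - A *ᵥ b ω) =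
      secondMoment P a a - secondMoment P a b * Aᵀ := by
    rw [← secondMoment_transpose, secondMoment_sub_left ha (memLp_mulVec A hb) ha,
      secondMoment_mulVec_left A hb ha, transpose_sub, transpose_mul, secondMoment_transpose,
      secondMoment_transpose]
  rw [secondMoment_sub_left ha (memLp_mulVec A hb) he, secondMoment_mulVec_left A hb he, hbe,
    Matrix.mul_zero, sub_zero, hae]

lemma lintegral_enorm_sq_eq_trace {a : Ω → EuclideanSpace ℝ ι}
    (ha : MemLp (fun ω => (a ω).ofLp) 2 P) :
    ∫⁻ ω, ‖a ω‖ₑ ^ 2 ∂P =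
      ENNReal.ofReal (secondMoment P (fun ω => (a ω).ofLp) (fun ω => (a ω).ofLp)).trace := by
  have hnorm (ω : Ω) : ‖a ω‖ₑ ^ 2 = ENNReal.ofReal (∑ i, a ω i * a ω i) := by
    rw [← ofReal_norm, ← ENNReal.ofReal_pow (norm_nonneg _), EuclideanSpace.real_norm_sq_eq]
    simp only [pow_two]
  have hint (i : ι) : Integrable (fun ω => a ω i * a ω i) P := integrable_mul_of_memLp ha ha i i
  simp only [hnorm]
  rw [← ofReal_integral_eq_lintegral_ofReal (integrable_finsetSum _ fun i _ => hint i)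
    (.of_forall fun ω => Finset.sum_nonneg fun i _ => mul_self_nonneg _),
    integral_finsetSum _ fun i _ => hint i]
  rfl

end SecondMoment

section PartialCovariance

open Matrix

variable {Ω Ω' α β ζ η : Type*} [MeasurableSpace Ω] [MeasurableSpace Ω'] {P : Measure Ω}
  [Fintype ζ] [DecidableEq ζ]

/-- The partial covariance `V_ab - V_az V_zz⁻¹ V_zb` of `a` and `b` given `z`: what is left of the
second moment `V_ab` after the linear least-mean-square estimates from `z` have been subtracted.
It is meaningful for invertible `V_zz` only. -/
noncomputable def partialCov (P : Measure Ω) (a : Ω → α → ℝ) (b : Ω → β → ℝ) (z : Ω → ζ → ℝ) :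
    Matrix α β ℝ :=
  secondMoment P a b - secondMoment P a z * (secondMoment P z z)⁻¹ * secondMoment P z b

variable {a a' : Ω → α → ℝ} {b : Ω → β → ℝ} {z : Ω → ζ → ℝ}

lemma transpose_inv_secondMoment : ((secondMoment P z z)⁻¹)ᵀ = (secondMoment P z z)⁻¹ := by
  rw [transpose_nonsing_inv, secondMoment_transpose]

lemma partialCov_transpose : (partialCov P a b z)ᵀ = partialCov P b a z := by
  simp only [partialCov, transpose_sub, transpose_mul, transpose_inv_secondMoment,
    secondMoment_transpose, Matrix.mul_assoc]

lemma partialCov_map {f : Ω → Ω'} (hf : Measurable f) {a : Ω' → α → ℝ} {b : Ω' → β → ℝ}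
    {z : Ω' → ζ → ℝ} (ha : Measurable a) (hb : Measurable b) (hz : Measurable z) :
    partialCov (P.map f) a b z =
      partialCov P (fun ω => a (f ω)) (fun ω => b (f ω)) (fun ω => z (f ω)) := by
  simp only [partialCov, secondMoment_map hf, ha, hb, hz]

lemma partialCov_eq_secondMoment (h : secondMoment P a z = 0) :
    partialCov P a b z = secondMoment P a b := by
  rw [partialCov, h, Matrix.zero_mul, Matrix.zero_mul, sub_zero]

lemma partialCov_self_left (hz : IsUnit (secondMoment P z z).det) : partialCov P z b z = 0 := by
  rw [partialCov, mul_nonsing_inv _ hz, Matrix.one_mul, sub_self]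

lemma isUnit_det_secondMoment_sumElim [Fintype β] [DecidableEq β]
    (hz : IsUnit (secondMoment P z z).det) (hbz : IsUnit (partialCov P b b z).det) :
    IsUnit (secondMoment P (fun ω => Sum.elim (b ω) (z ω))
      (fun ω => Sum.elim (b ω) (z ω))).det := by
  have : Invertible (secondMoment P z z) := invertibleOfIsUnitDet _ hz
  rw [secondMoment_sumElim, det_fromBlocks₂₂, invOf_eq_nonsing_inv]
  exact hz.mul hbz

variable [Fintype α] [Fintype β]

lemma partialCov_add_left (ha : MemLp a 2 P) (ha' : MemLp a' 2 P) (hb : MemLp b 2 P)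
    (hz : MemLp z 2 P) :
    partialCov P (fun ω => a ω + a' ω) b z = partialCov P a b z + partialCov P a' b z := by
  simp only [partialCov, secondMoment_add_left ha ha' hb, secondMoment_add_left ha ha' hz,
    Matrix.add_mul]
  abel

lemma partialCov_sub_left (ha : MemLp a 2 P) (ha' : MemLp a' 2 P) (hb : MemLp b 2 P)
    (hz : MemLp z 2 P) :
    partialCov P (fun ω => a ω - a' ω) b z = partialCov P a b z - partialCov P a' b z := by
  simp only [partialCov, secondMoment_sub_left ha ha' hb, secondMoment_sub_left ha ha' hz,
    Matrix.sub_mul]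
  abel

lemma partialCov_mulVec_left (A : Matrix η α ℝ) (ha : MemLp a 2 P) (hb : MemLp b 2 P)
    (hz : MemLp z 2 P) : partialCov P (fun ω => A *ᵥ a ω) b z = A * partialCov P a b z := by
  simp only [partialCov, secondMoment_mulVec_left A ha hb, secondMoment_mulVec_left A ha hz,
    Matrix.mul_sub, Matrix.mul_assoc]

lemma posSemidef_partialCov (ha : MemLp a 2 P) (hz : MemLp z 2 P)
    (hzz : IsUnit (secondMoment P z z).det) : (partialCov P a a z).PosSemidef := by
  have hnormal : secondMoment P a z * (secondMoment P z z)⁻¹ * secondMoment P z z =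
      secondMoment P a z := nonsing_inv_mul_cancel_right _ _ hzz
  have hres := secondMoment_residual ha hz hnormal
  rw [transpose_mul, transpose_inv_secondMoment, secondMoment_transpose, ← Matrix.mul_assoc]
    at hres
  rw [partialCov, ← hres]
  exact posSemidef_secondMoment (ha.sub (memLp_mulVec _ hz))

end PartialCovariance

section LinearEstimation

open Matrix

variable {Ω α β ζ κ : Type*} [MeasurableSpace Ω] {P : Measure Ω} [Fintype α] [Fintype β] [Fintype ζ]
  {a : Ω → α → ℝ} {b : Ω → κ → ℝ} {y : Ω → β → ℝ} {z : Ω → ζ → ℝ} {G : Matrix α (β ⊕ ζ) ℝ}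

lemma secondMoment_residual_left_eq_zero (ha : MemLp a 2 P) (hy : MemLp y 2 P) (hz : MemLp z 2 P)
    (hG : G * secondMoment P (fun ω => Sum.elim (y ω) (z ω)) (fun ω => Sum.elim (y ω) (z ω)) =
      secondMoment P a fun ω => Sum.elim (y ω) (z ω)) :
    secondMoment P (fun ω => a ω - G *ᵥ Sum.elim (y ω) (z ω)) y = 0 ∧
      secondMoment P (fun ω => a ω - G *ᵥ Sum.elim (y ω) (z ω)) z = 0 := by
  have h := secondMoment_residual_left ha (memLp_sumElim hy hz) hG
  rw [secondMoment_sumElim_right, ← fromCols_zero] at h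
  exact fromCols_inj h

variable [DecidableEq ζ]

lemma partialCov_residual_left [Fintype κ] (ha : MemLp a 2 P) (hy : MemLp y 2 P) (hz : MemLp z 2 P)
    (hb : MemLp b 2 P) (hzz : IsUnit (secondMoment P z z).det) :
    partialCov P (fun ω => a ω - G *ᵥ Sum.elim (y ω) (z ω)) b z =
      partialCov P a b z - G.toCols₁ * partialCov P y b z := by
  simp only [mulVec_sumElim_eq_add]
  have hGy : MemLp (fun ω => G.toCols₁ *ᵥ y ω) 2 P := memLp_mulVec _ hy
  have hGz : MemLp (fun ω => G.toCols₂ *ᵥ z ω) 2 P := memLp_mulVec _ hz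
  have hGyz : MemLp (fun ω => G.toCols₁ *ᵥ y ω + G.toCols₂ *ᵥ z ω) 2 P := hGy.add hGz
  rw [partialCov_sub_left ha hGyz hb hz, partialCov_add_left hGy hGz hb hz,
    partialCov_mulVec_left _ hy hb hz, partialCov_mulVec_left _ hz hb hz, partialCov_self_left hzz,
    Matrix.mul_zero, add_zero]

lemma toCols₁_mul_partialCov (ha : MemLp a 2 P) (hy : MemLp y 2 P) (hz : MemLp z 2 P)
    (hzz : IsUnit (secondMoment P z z).det)
    (hG : G * secondMoment P (fun ω => Sum.elim (y ω) (z ω)) (fun ω => Sum.elim (y ω) (z ω)) =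
      secondMoment P a fun ω => Sum.elim (y ω) (z ω)) :
    G.toCols₁ * partialCov P y y z = partialCov P a y z := by
  obtain ⟨hey, hez⟩ := secondMoment_residual_left_eq_zero ha hy hz hG
  have h := partialCov_residual_left (G := G) ha hy hz hy hzz
  rw [partialCov_eq_secondMoment hez, hey] at h
  exact (sub_eq_zero.mp h.symm).symm

lemma secondMoment_residual_eq_partialCov_sub (ha : MemLp a 2 P) (hy : MemLp y 2 P)
    (hz : MemLp z 2 P) (hzz : IsUnit (secondMoment P z z).det)
    (hG : G * secondMoment P (fun ω => Sum.elim (y ω) (z ω)) (fun ω => Sum.elim (y ω) (z ω)) =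
      secondMoment P a fun ω => Sum.elim (y ω) (z ω)) :
    secondMoment P (fun ω => a ω - G *ᵥ Sum.elim (y ω) (z ω))
        (fun ω => a ω - G *ᵥ Sum.elim (y ω) (z ω)) =
      partialCov P a a z - G.toCols₁ * partialCov P y y z * G.toCols₁ᵀ := by
  set e : Ω → α → ℝ := fun ω => a ω - G *ᵥ Sum.elim (y ω) (z ω)
  obtain ⟨hey, hez⟩ := secondMoment_residual_left_eq_zero ha hy hz hG
  have he : MemLp e 2 P := ha.sub (memLp_mulVec G (memLp_sumElim hy hz))
  have hye : partialCov P y e z = 0 := by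
    rw [← partialCov_transpose, partialCov_eq_secondMoment hez, hey, transpose_zero]
  have hae : partialCov P a e z =
      partialCov P a a z - G.toCols₁ * partialCov P y y z * G.toCols₁ᵀ := by
    rw [← partialCov_transpose, partialCov_residual_left ha hy hz ha hzz, transpose_sub,
      transpose_mul, partialCov_transpose, partialCov_transpose,
      toCols₁_mul_partialCov ha hy hz hzz hG]
  rw [← partialCov_eq_secondMoment hez, partialCov_residual_left ha hy hz he hzz, hye,
    Matrix.mul_zero, sub_zero, hae]

end LinearEstimation

section Gaussian

open Matrix

/-- A Gaussian measure with mean zero. -/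
structure IsCenteredGaussian {E : Type*} [NormedAddCommGroup E] [NormedSpace ℝ E]
    [MeasurableSpace E] (P : Measure E) : Prop where
  isGaussian : IsGaussian P
  integral_eq_zero : ∫ x, x ∂P = 0

variable {E F ι κ : Type*} [NormedAddCommGroup E] [NormedSpace ℝ E] [NormedAddCommGroup F]
  [NormedSpace ℝ F] {f : E → F}

lemma continuous_of_isLinearMap [FiniteDimensional ℝ E] (hf : IsLinearMap ℝ f) : Continuous f :=
  LinearMap.continuous_of_finiteDimensional (hf.mk' f)

lemma isLinearMap_ofLp {T : E → EuclideanSpace ℝ ι} (hT : IsLinearMap ℝ T) :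
    IsLinearMap ℝ fun x => (T x).ofLp :=
  ⟨fun x y => congrArg _ (hT.map_add x y), fun c x => congrArg _ (hT.map_smul c x)⟩

lemma isLinearMap_comp_fst {G : Type*} [AddCommGroup G] [Module ℝ G] (hf : IsLinearMap ℝ f) :
    IsLinearMap ℝ fun p : E × G => f p.1 :=
  ⟨fun p q => hf.map_add p.1 q.1, fun c p => hf.map_smul c p.1⟩

variable [MeasurableSpace E] {P : Measure E}

lemma memLp_of_isLinearMap [FiniteDimensional ℝ E] {p : ℝ≥0∞} (hP : MemLp id p P)
    (hf : IsLinearMap ℝ f) : MemLp f p P :=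
  (LinearMap.toContinuousLinearMap (hf.mk' f)).comp_memLp' hP

variable [BorelSpace E] [CompleteSpace F]

namespace IsCenteredGaussian

lemma prod [CompleteSpace E] [SecondCountableTopology E] [MeasurableSpace F] [BorelSpace F]
    [SecondCountableTopology F] {Q : Measure F} (hP : IsCenteredGaussian P)
    (hQ : IsCenteredGaussian Q) : IsCenteredGaussian (P.prod Q) := by
  have := hP.isGaussian
  have := hQ.isGaussian
  refine ⟨inferInstance, Prod.ext ?_ ?_⟩
  · rw [fst_integral IsGaussian.integrable_id]
    exact (integral_fun_fst fun x => x).trans (by rw [hP.integral_eq_zero, smul_zero]; rfl)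
  · rw [snd_integral IsGaussian.integrable_id]
    exact (integral_fun_snd fun x => x).trans (by rw [hQ.integral_eq_zero, smul_zero]; rfl)

variable [FiniteDimensional ℝ E]

lemma integral_of_isLinearMap (hP : IsCenteredGaussian P) (hf : IsLinearMap ℝ f) :
    ∫ x, f x ∂P = 0 := by
  have := hP.isGaussian
  have := FiniteDimensional.proper ℝ E
  calc ∫ x, f x ∂P = hf.mk' f (∫ x, x ∂P) :=
        (LinearMap.toContinuousLinearMap (hf.mk' f)).integral_comp_comm IsGaussian.integrable_id
    _ = 0 := by rw [hP.integral_eq_zero, map_zero]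

lemma hasGaussianLaw {F : Type*} [NormedAddCommGroup F] [NormedSpace ℝ F] [MeasurableSpace F]
    [BorelSpace F] {f : E → F} (hP : IsCenteredGaussian P) (hf : IsLinearMap ℝ f) :
    HasGaussianLaw f P :=
  have := hP.isGaussian
  IsGaussian.hasGaussianLaw_id.map (LinearMap.toContinuousLinearMap (hf.mk' f))

lemma memLp_id (hP : IsCenteredGaussian P) : MemLp id 2 P :=
  have := hP.isGaussian
  have := FiniteDimensional.proper ℝ E
  IsGaussian.memLp_two_id

lemma memLp_two {F : Type*} [NormedAddCommGroup F] [NormedSpace ℝ F] {f : E → F}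
    (hP : IsCenteredGaussian P) (hf : IsLinearMap ℝ f) : MemLp f 2 P :=
  memLp_of_isLinearMap hP.memLp_id hf

variable [MeasurableSpace F] [BorelSpace F] [SecondCountableTopology F]

lemma map (hP : IsCenteredGaussian P) (hf : IsLinearMap ℝ f) : IsCenteredGaussian (P.map f) where
  isGaussian := (hP.hasGaussianLaw hf).isGaussian_map
  integral_eq_zero :=
    (integral_map (continuous_of_isLinearMap hf).aemeasurable aestronglyMeasurable_id).trans
      (hP.integral_of_isLinearMap hf)

lemma indepFun_of_secondMoment_eq_zero [Finite ι] [Finite κ] {a : E → ι → ℝ} {b : E → κ → ℝ}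
    (hP : IsCenteredGaussian P) (ha : IsLinearMap ℝ a) (hb : IsLinearMap ℝ b)
    (h : secondMoment P a b = 0) : IndepFun a b P := by
  have := Fintype.ofFinite ι
  have := Fintype.ofFinite κ
  have := hP.isGaussian
  have hab : IsLinearMap ℝ fun x => (a x, b x) :=
    ⟨fun x y => Prod.ext (ha.map_add x y) (hb.map_add x y),
      fun c x => Prod.ext (ha.map_smul c x) (hb.map_smul c x)⟩
  have ha0 (i : ι) : ∫ x, a x i ∂P = 0 := hP.integral_of_isLinearMap
    ⟨fun x y => congrFun (ha.map_add x y) i, fun c x => congrFun (ha.map_smul c x) i⟩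
  refine HasGaussianLaw.indepFun_of_covariance_eval (hP.hasGaussianLaw hab) fun i j => ?_
  rw [covariance_eq_sub ((hP.memLp_two ha).eval i) ((hP.memLp_two hb).eval j), ha0, zero_mul,
    sub_zero]
  exact congrFun (congrFun h i) j

end IsCenteredGaussian

end Gaussian

section LeastMeanSquares

variable {Ω F O : Type*} [MeasurableSpace Ω] [MeasurableSpace O] [NormedAddCommGroup F]
  {P : Measure Ω}

lemma lintegral_enorm_sq_eq_ofReal {X : Ω → F} (hX : MemLp X 2 P) :
    ∫⁻ ω, ‖X ω‖ₑ ^ 2 ∂P = ENNReal.ofReal (∫ ω, ‖X ω‖ ^ 2 ∂P) := by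
  rw [ofReal_integral_eq_lintegral_ofReal hX.norm.integrable_sq (ae_of_all _ fun _ => sq_nonneg _)]
  refine lintegral_congr fun ω => ?_
  rw [← ofReal_norm, ENNReal.ofReal_pow (norm_nonneg _)]

variable [InnerProductSpace ℝ F] [CompleteSpace F] [IsProbabilityMeasure P]

lemma lintegral_enorm_sq_le_of_integral_eq_zero {X : Ω → F} (hX : MemLp X 2 P)
    (h0 : ∫ ω, X ω ∂P = 0) (c : F) :
    ∫⁻ ω, ‖X ω‖ₑ ^ 2 ∂P ≤ ∫⁻ ω, ‖X ω + c‖ₑ ^ 2 ∂P := by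
  have hXi : Integrable X P := hX.integrable one_le_two
  have hXc : MemLp (fun ω => X ω + c) 2 P := hX.add (memLp_const c)
  rw [lintegral_enorm_sq_eq_ofReal hX, lintegral_enorm_sq_eq_ofReal hXc]
  refine ENNReal.ofReal_le_ofReal ?_
  have hsq : Integrable (fun ω => ‖X ω‖ ^ 2) P := hX.norm.integrable_sq
  have hinner : Integrable (fun ω => 2 * inner ℝ c (X ω)) P := (hXi.const_inner c).const_mul 2
  calc ∫ ω, ‖X ω‖ ^ 2 ∂P ≤ ∫ ω, ‖X ω‖ ^ 2 ∂P + ‖c‖ ^ 2 := le_add_of_nonneg_right (sq_nonneg _)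
    _ = ∫ ω, (‖X ω‖ ^ 2 + 2 * inner ℝ c (X ω) + ‖c‖ ^ 2) ∂P := by
        rw [integral_add (by exact hsq.add hinner) (integrable_const _), integral_add hsq hinner,
          integral_const_mul, integral_inner hXi, h0]
        simp
    _ = ∫ ω, ‖X ω + c‖ ^ 2 ∂P := by simp only [norm_add_sq_real, real_inner_comm]

variable [MeasurableSpace F] [BorelSpace F] [SecondCountableTopology F]

lemma lintegral_enorm_sq_sub_le_of_indepFun {T : Ω → F} {Z : Ω → O} {g : O → F}
    (hT : Measurable T) (hZ : Measurable Z) (hg : Measurable g)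
    (hres : MemLp (fun ω => T ω - g (Z ω)) 2 P) (h0 : ∫ ω, T ω - g (Z ω) ∂P = 0)
    (hind : IndepFun (fun ω => T ω - g (Z ω)) Z P) (η : Kernel O F) [IsMarkovKernel η] :
    ∫⁻ ω, ‖T ω - g (Z ω)‖ₑ ^ 2 ∂P ≤ ∫⁻ ω, ∫⁻ e, ‖T ω - e‖ₑ ^ 2 ∂(η (Z ω)) ∂P := by
  set X : Ω → F := fun ω => T ω - g (Z ω)
  have hX : Measurable X := hT.sub (hg.comp hZ)
  have : IsProbabilityMeasure (P.map Z) := Measure.isProbabilityMeasure_map hZ.aemeasurable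
  have : IsProbabilityMeasure (P.map X) := Measure.isProbabilityMeasure_map hX.aemeasurable
  have hdist : Measurable fun q : (F × O) × F => ‖q.1.1 + (g q.1.2 - q.2)‖ₑ ^ 2 := by fun_prop
  have hcond : Measurable fun q : F × O => ∫⁻ e, ‖q.1 + (g q.2 - e)‖ₑ ^ 2 ∂(η q.2) :=
    hdist.lintegral_kernel_prod_right' (κ := η.comap Prod.snd measurable_snd)
  calc ∫⁻ ω, ‖X ω‖ₑ ^ 2 ∂P
      = ∫⁻ o, ∫⁻ _, ∫⁻ ω, ‖X ω‖ₑ ^ 2 ∂P ∂(η o) ∂(P.map Z) := by simp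
    _ ≤ ∫⁻ o, ∫⁻ e, ∫⁻ ω, ‖X ω + (g o - e)‖ₑ ^ 2 ∂P ∂(η o) ∂(P.map Z) :=
        lintegral_mono fun o => lintegral_mono fun e =>
          lintegral_enorm_sq_le_of_integral_eq_zero hres h0 _
    _ = ∫⁻ o, ∫⁻ e, ∫⁻ x, ‖x + (g o - e)‖ₑ ^ 2 ∂(P.map X) ∂(η o) ∂(P.map Z) := by
        refine lintegral_congr fun o => lintegral_congr fun e => ?_
        rw [lintegral_map (by fun_prop) hX]
    _ = ∫⁻ o, ∫⁻ x, ∫⁻ e, ‖x + (g o - e)‖ₑ ^ 2 ∂(η o) ∂(P.map X) ∂(P.map Z) :=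
        lintegral_congr fun o => lintegral_lintegral_swap (by fun_prop)
    _ = ∫⁻ q, ∫⁻ e, ‖q.1 + (g q.2 - e)‖ₑ ^ 2 ∂(η q.2) ∂((P.map X).prod (P.map Z)) :=
        (lintegral_prod_symm _ hcond.aemeasurable).symm
    _ = ∫⁻ q, ∫⁻ e, ‖q.1 + (g q.2 - e)‖ₑ ^ 2 ∂(η q.2) ∂(P.map fun ω => (X ω, Z ω)) := by
        rw [(indepFun_iff_map_prod_eq_prod_map_map hX.aemeasurable hZ.aemeasurable).mp hind]
    _ = ∫⁻ ω, ∫⁻ e, ‖T ω - e‖ₑ ^ 2 ∂(η (Z ω)) ∂P := by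
        rw [lintegral_map hcond (hX.prodMk hZ)]
        simp only [X, sub_add_sub_cancel]

end LeastMeanSquares

section GaussianEstimation

open Matrix

variable {E ι κ : Type*} [NormedAddCommGroup E] [NormedSpace ℝ E] [FiniteDimensional ℝ E]
  [MeasurableSpace E] [BorelSpace E] [Fintype ι] [Fintype κ] {P : Measure E}

lemma IsCenteredGaussian.lintegral_residual_le (hP : IsCenteredGaussian P)
    {T : E → EuclideanSpace ℝ ι} {b : E → κ → ℝ} (hT : IsLinearMap ℝ T) (hb : IsLinearMap ℝ b)
    {A : Matrix ι κ ℝ}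
    (hA : A * secondMoment P b b = secondMoment P (fun x => (T x).ofLp) b)
    (η : Kernel (κ → ℝ) (EuclideanSpace ℝ ι)) [IsMarkovKernel η] :
    ∫⁻ x, ‖T x - WithLp.toLp 2 (A *ᵥ b x)‖ₑ ^ 2 ∂P ≤
      ∫⁻ x, ∫⁻ e, ‖T x - e‖ₑ ^ 2 ∂(η (b x)) ∂P := by
  have := hP.isGaussian
  have hT' : IsLinearMap ℝ fun x => (T x).ofLp := isLinearMap_ofLp hT
  have hres : IsLinearMap ℝ fun x => (T x).ofLp - A *ᵥ b x :=
    ⟨fun x y => by rw [hT'.map_add, hb.map_add, mulVec_add, add_sub_add_comm],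
      fun c x => by rw [hT'.map_smul, hb.map_smul, mulVec_smul, smul_sub]⟩
  have hres' : IsLinearMap ℝ fun x => T x - WithLp.toLp 2 (A *ᵥ b x) :=
    ⟨fun x y => congrArg (WithLp.toLp 2) (hres.map_add x y),
      fun c x => congrArg (WithLp.toLp 2) (hres.map_smul c x)⟩
  have hind : IndepFun (fun x => (T x).ofLp - A *ᵥ b x) b P :=
    hP.indepFun_of_secondMoment_eq_zero hres hb
      (secondMoment_residual_left (hP.memLp_two hT') (hP.memLp_two hb) hA)
  have hA_meas : Measurable fun v : κ → ℝ => WithLp.toLp 2 (A *ᵥ v) :=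
    (WithLp.measurable_toLp 2 _).comp
      (Continuous.matrix_mulVec continuous_const continuous_id).measurable
  exact lintegral_enorm_sq_sub_le_of_indepFun
    (g := fun v => WithLp.toLp 2 (A *ᵥ v)) (continuous_of_isLinearMap hT).measurable
    (continuous_of_isLinearMap hb).measurable hA_meas (hP.memLp_two hres')
    (hP.integral_of_isLinearMap hres') (hind.comp (WithLp.measurable_toLp 2 _) measurable_id) η

end GaussianEstimation

section Policies

variable {nx nw nz ny : ℕ} {μ : Measure (State nx nw nz)} {γ : Sender nx nw nz ny}

lemma isLinearMap_stateX : IsLinearMap ℝ fun s : State nx nw nz => s.1 where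
  map_add _ _ := rfl
  map_smul _ _ := rfl

lemma isLinearMap_stateW : IsLinearMap ℝ fun s : State nx nw nz => s.2.1 where
  map_add _ _ := rfl
  map_smul _ _ := rfl

lemma isLinearMap_vecXW : IsLinearMap ℝ (vecXW : State nx nw nz → Fin nx ⊕ Fin nw → ℝ) where
  map_add _ _ := by ext (_ | _) <;> rfl
  map_smul _ _ := by ext (_ | _) <;> rfl

lemma isLinearMap_vecZ : IsLinearMap ℝ (vecZ : State nx nw nz → Fin nz → ℝ) where
  map_add _ _ := rfl
  map_smul _ _ := rfl

lemma isLinearMap_vecYZ :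
    IsLinearMap ℝ fun p : State nx nw nz × Vec ny => vecYZ p.2 p.1.2.2 where
  map_add _ _ := by ext (_ | _) <;> rfl
  map_smul _ _ := by ext (_ | _) <;> rfl

instance [IsProbabilityMeasure μ] : IsProbabilityMeasure (jointLaw μ γ) := by
  unfold jointLaw
  infer_instance

lemma map_fst_jointLaw [IsProbabilityMeasure μ] : (jointLaw μ γ).map Prod.fst = μ :=
  Measure.fst_compProd μ γ.kernel

lemma hasFiniteSecondMoment_iff_memLp :
    HasFiniteSecondMoment μ γ ↔
      MemLp (fun p : State nx nw nz × Vec ny => p.2) 2 (jointLaw μ γ) := by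
  rw [MemLp, and_iff_right measurable_snd.aestronglyMeasurable,
    eLpNorm_lt_top_iff_lintegral_rpow_enorm_lt_top two_ne_zero ENNReal.ofNat_ne_top]
  simp [HasFiniteSecondMoment]

lemma HasFiniteSecondMoment.memLp_id [IsProbabilityMeasure μ] (h : HasFiniteSecondMoment μ γ)
    (hμ : MemLp id 2 μ) : MemLp id 2 (jointLaw μ γ) := by
  have hs : MemLp id 2 ((jointLaw μ γ).map Prod.fst) := by rwa [map_fst_jointLaw]
  exact MemLp.of_fst_snd ⟨hs.comp_of_map measurable_fst.aemeasurable,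
    hasFiniteSecondMoment_iff_memLp.mp h⟩

lemma hasFiniteSecondMoment_of_memLp_id (h : MemLp id 2 (jointLaw μ γ)) :
    HasFiniteSecondMoment μ γ :=
  hasFiniteSecondMoment_iff_memLp.mpr (memLp_of_isLinearMap h (LinearMap.snd ℝ _ _).isLinear)

lemma jointLaw_scale [SFinite μ] (κ : Matrix (Fin ny) (Fin ny) ℝ) :
    jointLaw μ (γ.scale κ) = (jointLaw μ γ).map (Prod.map id κ.toEuclideanLin) :=
  Measure.compProd_map
    (LinearMap.continuous_of_finiteDimensional κ.toEuclideanLin).measurable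

lemma isLinearMap_map_id_toEuclideanLin (κ : Matrix (Fin ny) (Fin ny) ℝ) :
    IsLinearMap ℝ (Prod.map id κ.toEuclideanLin : State nx nw nz × Vec ny → _) :=
  (LinearMap.id.prodMap κ.toEuclideanLin).isLinear

end Policies

section Estimators

open Matrix

variable {nx nw nz ny n : ℕ} {μ : Measure (State nx nw nz)} {γ : Sender nx nw nz ny}
  {target : State nx nw nz → Vec n}

lemma measurable_vecYZ : Measurable fun o : Vec ny × Vec nz => vecYZ o.1 o.2 :=
  measurable_pi_lambda _ <| Sum.rec
    (fun i => show Measurable fun o : Vec ny × Vec nz => o.1 i by fun_prop)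
    (fun i => show Measurable fun o : Vec ny × Vec nz => o.2 i by fun_prop)

lemma measurable_gain (A : Matrix (Fin n) (Fin ny ⊕ Fin nz) ℝ) :
    Measurable fun o : Vec ny × Vec nz => (WithLp.toLp 2 (A *ᵥ vecYZ o.1 o.2) : Vec n) :=
  (WithLp.measurable_toLp 2 _).comp
    ((Continuous.matrix_mulVec continuous_const continuous_id).measurable.comp measurable_vecYZ)

/-- The estimator that maps `(y, z)` to `A (y, z)` without further randomization. -/
noncomputable def linearEstimator (A : Matrix (Fin n) (Fin ny ⊕ Fin nz) ℝ) :
    Estimator ny nz n where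
  kernel := Kernel.deterministic _ (measurable_gain A)
  isMarkov := inferInstance

lemma usesGain_linearEstimator (A : Matrix (Fin n) (Fin ny ⊕ Fin nz) ℝ) :
    UsesGain μ γ (linearEstimator A) A :=
  ae_of_all _ fun _ => by
    simp only [linearEstimator, Kernel.deterministic_apply]
    exact (ae_dirac_iff (measurableSet_singleton _)).mpr rfl

lemma estimationCost_eq [SFinite μ] (ht : Measurable target) (η : Estimator ny nz n) :
    estimationCost μ target γ η =
      ∫⁻ p, ∫⁻ e, ‖target p.1 - e‖ₑ ^ 2 ∂(η.kernel (p.2, p.1.2.2)) ∂(jointLaw μ γ) := by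
  have hdist : Measurable fun q : (State nx nw nz × Vec ny) × Vec n =>
      ‖target q.1.1 - q.2‖ₑ ^ 2 := by
    fun_prop
  exact (Measure.lintegral_compProd (hdist.lintegral_kernel_prod_right'
    (κ := η.kernel.comap (fun p : State nx nw nz × Vec ny => (p.2, p.1.2.2)) (by fun_prop)))).symm

lemma estimationCost_linearEstimator [SFinite μ] (ht : Measurable target)
    (A : Matrix (Fin n) (Fin ny ⊕ Fin nz) ℝ) :
    estimationCost μ target γ (linearEstimator A) =
      ∫⁻ p, ‖target p.1 - WithLp.toLp 2 (A *ᵥ vecYZ p.2 p.1.2.2)‖ₑ ^ 2 ∂(jointLaw μ γ) := by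
  simp only [estimationCost_eq ht, linearEstimator, Kernel.deterministic_apply, lintegral_dirac]

/-- The gain of the linear least-mean-square estimator of the target. If `E‖y‖² = ∞`, where the
moments of `y` are junk values, it is the gain of the best linear estimator that ignores the
message. -/
noncomputable def lmsGain (μ : Measure (State nx nw nz)) (target : State nx nw nz → Vec n)
    (γ : Sender nx nw nz ny) : Matrix (Fin n) (Fin ny ⊕ Fin nz) ℝ :=
  open Classical in
  if HasFiniteSecondMoment μ γ then
    Classical.epsilon fun A => A * obsMoment μ γ = crossMoment μ target γ
  else fromCols 0 (secondMoment μ (fun s => target s) vecZ * (secondMoment μ vecZ vecZ)⁻¹)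

lemma lmsGain_mul_obsMoment (hJ : MemLp id 2 (jointLaw μ γ)) (ht : IsLinearMap ℝ target) :
    lmsGain μ target γ * obsMoment μ γ = crossMoment μ target γ := by
  rw [lmsGain, if_pos (hasFiniteSecondMoment_of_memLp_id hJ)]
  exact Classical.epsilon_spec (exists_mul_secondMoment_eq
    (memLp_of_isLinearMap hJ (isLinearMap_comp_fst (isLinearMap_ofLp ht)))
    (memLp_of_isLinearMap hJ isLinearMap_vecYZ))

lemma lmsGain_mulVec_of_not (h : ¬ HasFiniteSecondMoment μ γ) (y : Vec ny) (z : Vec nz) :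
    lmsGain μ target γ *ᵥ vecYZ y z =
      (secondMoment μ (fun s => target s) vecZ * (secondMoment μ vecZ vecZ)⁻¹) *ᵥ z := by
  rw [lmsGain, if_neg h, vecYZ, fromCols_mulVec_sumElim, zero_mulVec, zero_add]

lemma eq_crossMoment_mul_inv {A : Matrix (Fin n) (Fin ny ⊕ Fin nz) ℝ}
    (hA : A * obsMoment μ γ = crossMoment μ target γ) (h : IsUnit (obsMoment μ γ).det) :
    A = crossMoment μ target γ * (obsMoment μ γ)⁻¹ := by
  rw [← hA, mul_nonsing_inv_cancel_right _ _ h]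

/-- The linear least-mean-square estimator of the target. -/
noncomputable def lmsEstimator (μ : Measure (State nx nw nz)) (target : State nx nw nz → Vec n)
    (γ : Sender nx nw nz ny) : Estimator ny nz n :=
  linearEstimator (lmsGain μ target γ)

lemma isLinearLMS_lmsEstimator (hJ : MemLp id 2 (jointLaw μ γ)) (ht : IsLinearMap ℝ target) :
    IsLinearLMS μ target γ (lmsEstimator μ target γ) :=
  ⟨lmsGain μ target γ, lmsGain_mul_obsMoment hJ ht,
    eq_crossMoment_mul_inv (lmsGain_mul_obsMoment hJ ht), usesGain_linearEstimator _⟩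

lemma IsLinearLMS.usesGain_crossMoment_mul_inv {η : Estimator ny nz n}
    (h : IsLinearLMS μ target γ η) (hdet : IsUnit (obsMoment μ γ).det) :
    UsesGain μ γ η (crossMoment μ target γ * (obsMoment μ γ)⁻¹) := by
  obtain ⟨A, -, hinv, hA⟩ := h
  exact hinv hdet ▸ hA

lemma estimationCost_lmsEstimator_le [SFinite μ] (hJ : IsCenteredGaussian (jointLaw μ γ))
    (ht : IsLinearMap ℝ target) (η : Estimator ny nz n) :
    estimationCost μ target γ (lmsEstimator μ target γ) ≤ estimationCost μ target γ η := by
  have htm : Measurable target := (continuous_of_isLinearMap ht).measurable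
  rw [lmsEstimator, estimationCost_linearEstimator htm, estimationCost_eq htm]
  have hsplit : Measurable fun v : Fin ny ⊕ Fin nz → ℝ =>
      ((WithLp.toLp 2 fun i => v (.inl i) : Vec ny),
        (WithLp.toLp 2 fun i => v (.inr i) : Vec nz)) := by
    fun_prop
  exact hJ.lintegral_residual_le (isLinearMap_comp_fst ht) isLinearMap_vecYZ
    (lmsGain_mul_obsMoment hJ.memLp_id ht) (η.kernel.comap _ hsplit)

end Estimators

section ErrorCovariance

open Matrix

variable {nx nw nz ny : ℕ} {μ : Measure (State nx nw nz)} {γ : Sender nx nw nz ny}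
  {S : Matrix (Fin nx ⊕ Fin nw) (Fin nx ⊕ Fin nw) ℝ}

/-- The gain of the two linear least-mean-square estimators, stacked as an estimator of `(x, w)`. -/
noncomputable def stackedGain (μ : Measure (State nx nw nz)) (γ : Sender nx nw nz ny) :
    Matrix (Fin nx ⊕ Fin nw) (Fin ny ⊕ Fin nz) ℝ :=
  fromRows (lmsGain μ (fun s => s.1) γ) (lmsGain μ (fun s => s.2.1) γ)

/-- The error `(x - x̂, w - ŵ)` of the two linear least-mean-square estimators. -/
noncomputable def estimationError (μ : Measure (State nx nw nz)) (γ : Sender nx nw nz ny)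
    (p : State nx nw nz × Vec ny) : Fin nx ⊕ Fin nw → ℝ :=
  vecXW p.1 - stackedGain μ γ *ᵥ vecYZ p.2 p.1.2.2

/-- The costs of the receiver and of the malicious agent are the traces of the two diagonal blocks
of the positive semidefinite matrix `S` when both estimate by linear least mean squares. -/
structure HasErrorCov (μ : Measure (State nx nw nz)) (γ : Sender nx nw nz ny)
    (S : Matrix (Fin nx ⊕ Fin nw) (Fin nx ⊕ Fin nw) ℝ) : Prop where
  posSemidef : S.PosSemidef
  receiverCost_eq :
    receiverCost μ γ (lmsEstimator μ (fun s => s.1) γ) = ENNReal.ofReal S.toBlocks₁₁.trace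
  maliciousCost_eq :
    maliciousCost μ γ (lmsEstimator μ (fun s => s.2.1) γ) = ENNReal.ofReal S.toBlocks₂₂.trace

/-- The partial covariance of the message given the side information. -/
noncomputable def messageCov (μ : Measure (State nx nw nz)) (γ : Sender nx nw nz ny) :
    Matrix (Fin ny) (Fin ny) ℝ :=
  partialCov (jointLaw μ γ) (fun p => p.2) (fun p => p.2) (fun p => vecZ p.1)

/-- The partial covariance of the message and `(x, w)` given the side information. -/
noncomputable def messageCrossCov (μ : Measure (State nx nw nz)) (γ : Sender nx nw nz ny) :
    Matrix (Fin ny) (Fin nx ⊕ Fin nw) ℝ :=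
  partialCov (jointLaw μ γ) (fun p => p.2) (fun p => vecXW p.1) (fun p => vecZ p.1)

lemma hasErrorCov_secondMoment [SFinite μ] (h : MemLp (estimationError μ γ) 2 (jointLaw μ γ)) :
    HasErrorCov μ γ (secondMoment (jointLaw μ γ) (estimationError μ γ) (estimationError μ γ)) where
  posSemidef := posSemidef_secondMoment h
  receiverCost_eq :=
    (estimationCost_linearEstimator (by fun_prop) _).trans
      (lintegral_enorm_sq_eq_trace (MemLp.of_eval fun i => h.eval (.inl i)))
  maliciousCost_eq :=
    (estimationCost_linearEstimator (by fun_prop) _).trans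
      (lintegral_enorm_sq_eq_trace (MemLp.of_eval fun i => h.eval (.inr i)))

lemma stackedGain_mul_obsMoment (hJ : MemLp id 2 (jointLaw μ γ)) :
    stackedGain μ γ * obsMoment μ γ =
      secondMoment (jointLaw μ γ) (fun p => vecXW p.1) (fun p => vecYZ p.2 p.1.2.2) := by
  rw [stackedGain, fromRows_mul, lmsGain_mul_obsMoment hJ isLinearMap_stateX,
    lmsGain_mul_obsMoment hJ isLinearMap_stateW]
  ext (_ | _) _ <;> rfl

@[fun_prop]
lemma measurable_vecZ : Measurable (vecZ : State nx nw nz → Fin nz → ℝ) :=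
  (continuous_of_isLinearMap isLinearMap_vecZ).measurable

@[fun_prop]
lemma measurable_vecXW : Measurable (vecXW : State nx nw nz → Fin nx ⊕ Fin nw → ℝ) :=
  (continuous_of_isLinearMap isLinearMap_vecXW).measurable

lemma memLp_vecXW_fst (hJ : MemLp id 2 (jointLaw μ γ)) :
    MemLp (fun p : State nx nw nz × Vec ny => vecXW p.1) 2 (jointLaw μ γ) :=
  memLp_of_isLinearMap hJ (isLinearMap_comp_fst isLinearMap_vecXW)

lemma memLp_vecZ_fst (hJ : MemLp id 2 (jointLaw μ γ)) :
    MemLp (fun p : State nx nw nz × Vec ny => vecZ p.1) 2 (jointLaw μ γ) :=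
  memLp_of_isLinearMap hJ (isLinearMap_comp_fst isLinearMap_vecZ)

lemma memLp_snd (hJ : MemLp id 2 (jointLaw μ γ)) :
    MemLp (fun p : State nx nw nz × Vec ny => p.2.ofLp) 2 (jointLaw μ γ) :=
  memLp_of_isLinearMap hJ (isLinearMap_ofLp (LinearMap.snd ℝ _ _).isLinear)

variable [IsProbabilityMeasure μ]

lemma secondMoment_jointLaw_fst {ι κ : Type*} {a : State nx nw nz → ι → ℝ}
    {b : State nx nw nz → κ → ℝ} (ha : Measurable a) (hb : Measurable b) :
    secondMoment (jointLaw μ γ) (fun p => a p.1) (fun p => b p.1) = secondMoment μ a b := by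
  rw [← secondMoment_map measurable_fst ha hb, map_fst_jointLaw]

lemma partialCov_jointLaw_fst :
    partialCov (jointLaw μ γ) (fun p => vecXW p.1) (fun p => vecXW p.1) (fun p => vecZ p.1) =
      schurCov μ := by
  rw [← partialCov_map measurable_fst measurable_vecXW measurable_vecXW measurable_vecZ,
    map_fst_jointLaw]
  rfl

lemma posSemidef_messageCov (hJ : MemLp id 2 (jointLaw μ γ))
    (hzz : IsUnit (secondMoment μ vecZ vecZ).det) : (messageCov μ γ).PosSemidef := by
  rw [← secondMoment_jointLaw_fst measurable_vecZ measurable_vecZ (γ := γ)] at hzz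
  exact posSemidef_partialCov (memLp_snd hJ) (memLp_vecZ_fst hJ) hzz

lemma toCols₁_stackedGain_mul_messageCov (hJ : MemLp id 2 (jointLaw μ γ))
    (hzz : IsUnit (secondMoment μ vecZ vecZ).det) :
    (stackedGain μ γ).toCols₁ * messageCov μ γ = (messageCrossCov μ γ)ᵀ := by
  rw [← secondMoment_jointLaw_fst measurable_vecZ measurable_vecZ (γ := γ)] at hzz
  rw [messageCrossCov, partialCov_transpose]
  exact toCols₁_mul_partialCov (memLp_vecXW_fst hJ) (memLp_snd hJ) (memLp_vecZ_fst hJ) hzz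
    (stackedGain_mul_obsMoment hJ)

lemma hasErrorCov_stackedGain (hJ : MemLp id 2 (jointLaw μ γ))
    (hzz : IsUnit (secondMoment μ vecZ vecZ).det) :
    HasErrorCov μ γ (schurCov μ -
      (stackedGain μ γ).toCols₁ * messageCov μ γ * (stackedGain μ γ).toCols₁ᵀ) := by
  rw [← secondMoment_jointLaw_fst measurable_vecZ measurable_vecZ (γ := γ)] at hzz
  have hs := memLp_vecXW_fst hJ
  have hz := memLp_vecZ_fst hJ
  have hy := memLp_snd hJ
  have hcov := secondMoment_residual_eq_partialCov_sub hs hy hz hzz (stackedGain_mul_obsMoment hJ)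
  rw [partialCov_jointLaw_fst] at hcov
  exact hcov ▸ hasErrorCov_secondMoment (hs.sub (memLp_mulVec _ (memLp_sumElim hy hz)))

lemma hasErrorCov_of_mul_messageCov (hJ : MemLp id 2 (jointLaw μ γ))
    (hzz : IsUnit (secondMoment μ vecZ vecZ).det) {L : Matrix (Fin nx ⊕ Fin nw) (Fin ny) ℝ}
    (hL : L * messageCov μ γ = (messageCrossCov μ γ)ᵀ) :
    HasErrorCov μ γ (schurCov μ - L * messageCov μ γ * Lᵀ) := by
  set G := (stackedGain μ γ).toCols₁
  have hLG : L * messageCov μ γ = G * messageCov μ γ :=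
    hL.trans (toCols₁_stackedGain_mul_messageCov hJ hzz).symm
  have hLG' : messageCov μ γ * Lᵀ = messageCov μ γ * Gᵀ := by
    have hsymm : (messageCov μ γ)ᵀ = messageCov μ γ := partialCov_transpose
    simpa only [transpose_mul, hsymm] using congrArg transpose hLG
  rw [Matrix.mul_assoc, hLG', ← Matrix.mul_assoc, hLG]
  exact hasErrorCov_stackedGain hJ hzz

lemma hasErrorCov_of_not_hasFiniteSecondMoment (hμ : MemLp id 2 μ)
    (hzz : IsUnit (secondMoment μ vecZ vecZ).det) (h : ¬ HasFiniteSecondMoment μ γ) :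
    HasErrorCov μ γ (schurCov μ) := by
  set A := secondMoment μ vecXW vecZ * (secondMoment μ vecZ vecZ)⁻¹ with hA_def
  have hA : A * secondMoment μ vecZ vecZ = secondMoment μ vecXW vecZ :=
    nonsing_inv_mul_cancel_right _ _ hzz
  have hs : MemLp vecXW 2 μ := memLp_of_isLinearMap hμ isLinearMap_vecXW
  have hz : MemLp vecZ 2 μ := memLp_of_isLinearMap hμ isLinearMap_vecZ
  have hres : MemLp (fun s => vecXW s - A *ᵥ vecZ s) 2 ((jointLaw μ γ).map Prod.fst) := by
    rw [map_fst_jointLaw]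
    exact hs.sub (memLp_mulVec A hz)
  have hres_meas : Measurable fun s : State nx nw nz => vecXW s - A *ᵥ vecZ s := by
    have hA_meas : Measurable fun v : Fin nz → ℝ => A *ᵥ v :=
      (Continuous.matrix_mulVec continuous_const continuous_id).measurable
    exact measurable_vecXW.sub (hA_meas.comp measurable_vecZ)
  have herr : estimationError μ γ = fun p => vecXW p.1 - A *ᵥ vecZ p.1 := by
    ext p (i | i)
    · exact congrArg (p.1.1 i - ·) (congrFun (lmsGain_mulVec_of_not h p.2 p.1.2.2) i)
    · exact congrArg (p.1.2.1 i - ·) (congrFun (lmsGain_mulVec_of_not h p.2 p.1.2.2) i)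
  have hcov : schurCov μ =
      secondMoment (jointLaw μ γ) (estimationError μ γ) (estimationError μ γ) := by
    rw [herr, secondMoment_jointLaw_fst hres_meas hres_meas, secondMoment_residual hs hz hA,
      hA_def, transpose_mul, transpose_inv_secondMoment, secondMoment_transpose,
      ← Matrix.mul_assoc]
    rfl
  rw [hcov]
  exact hasErrorCov_secondMoment (herr ▸ hres.comp_of_map measurable_fst.aemeasurable)

end ErrorCovariance

section Program

open Matrix

variable {nx nw nz ny : ℕ} {μ : Measure (State nx nw nz)} {γ : Sender nx nw nz ny}
  {K : Matrix (Fin ny) (Fin nx ⊕ Fin nw) ℝ} {δ : ℝ}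

/-- The amount `Ξ Kᵀ K Ξ` by which a message of gain `K` reduces the error covariance `Ξ` of the
estimates from the side information alone. -/
noncomputable def errorReduction (μ : Measure (State nx nw nz))
    (K : Matrix (Fin ny) (Fin nx ⊕ Fin nw) ℝ) : Matrix (Fin nx ⊕ Fin nw) (Fin nx ⊕ Fin nw) ℝ :=
  schurCov μ * Kᵀ * K * schurCov μ

lemma schurCov_transpose : (schurCov μ)ᵀ = schurCov μ :=
  partialCov_transpose

/-- The covariance `Ξ - Ξ Kᵀ K Ξ` of the estimation errors under `gaussianSender μ K`. -/
noncomputable def errorCov (μ : Measure (State nx nw nz))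
    (K : Matrix (Fin ny) (Fin nx ⊕ Fin nw) ℝ) : Matrix (Fin nx ⊕ Fin nw) (Fin nx ⊕ Fin nw) ℝ :=
  schurCov μ - errorReduction μ K

lemma posDef_secondMoment_vecZ (hcov : (secondMoment μ vecXWZ vecXWZ).PosDef) :
    (secondMoment μ vecZ vecZ).PosDef :=
  hcov.submatrix Sum.inr_injective

lemma posDef_schurCov (hcov : (secondMoment μ vecXWZ vecXWZ).PosDef) : (schurCov μ).PosDef := by
  have hblocks : secondMoment μ vecXWZ vecXWZ = fromBlocks (secondMoment μ vecXW vecXW)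
      (secondMoment μ vecXW vecZ) (secondMoment μ vecXW vecZ)ᵀ (secondMoment μ vecZ vecZ) := by
    rw [secondMoment_transpose]
    exact secondMoment_sumElim _ _ _ _
  have hschur := posDef_schurComplement (hblocks ▸ hcov)
  rwa [secondMoment_transpose] at hschur

lemma zero_mem_feasible : (0 : Matrix (Fin ny) (Fin nx ⊕ Fin nw) ℝ) ∈ feasible μ ny := by
  simpa [feasible] using PosSemidef.one

lemma exists_feasible_hasErrorCov [IsProbabilityMeasure μ] (hμ : MemLp id 2 μ)
    (hcov : (secondMoment μ vecXWZ vecXWZ).PosDef) (γ : Sender nx nw nz ny) :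
    ∃ K ∈ feasible μ ny, HasErrorCov μ γ (errorCov μ K) := by
  have hX := posDef_schurCov hcov
  have hzz := isUnit_det_of_posDef (posDef_secondMoment_vecZ hcov)
  by_cases h : HasFiniteSecondMoment μ γ
  · have hJ := h.memLp_id hμ
    obtain ⟨K, hK, hKS⟩ := exists_gain_of_reduction hX (posSemidef_messageCov hJ hzz)
      (hasErrorCov_stackedGain hJ hzz).posSemidef
    refine ⟨K, hK, ?_⟩
    rw [errorCov, errorReduction, hKS]
    exact hasErrorCov_stackedGain hJ hzz
  · refine ⟨0, zero_mem_feasible, ?_⟩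
    simpa [errorCov, errorReduction] using hasErrorCov_of_not_hasFiniteSecondMoment hμ hzz h

lemma trace_fromBlocks_neg_one_smul_one_mul (δ : ℝ)
    (M : Matrix (Fin nx ⊕ Fin nw) (Fin nx ⊕ Fin nw) ℝ) :
    (fromBlocks (-1) 0 0 (δ • 1) * M).trace = δ * M.toBlocks₂₂.trace - M.toBlocks₁₁.trace := by
  conv_lhs => rw [← fromBlocks_toBlocks M, fromBlocks_multiply]
  simp [trace, Finset.mul_sum, sub_eq_neg_add]

lemma objective_eq :
    objective μ δ K =
      δ * (errorReduction μ K).toBlocks₂₂.trace - (errorReduction μ K).toBlocks₁₁.trace := by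
  rw [← trace_fromBlocks_neg_one_smul_one_mul, objective, Matrix.mul_assoc, Matrix.mul_assoc,
    trace_mul_comm (K * schurCov μ), errorReduction]
  simp only [Matrix.mul_assoc]

lemma HasErrorCov.senderCost_eq (h : HasErrorCov μ γ (errorCov μ K)) :
    senderCost μ δ γ (lmsEstimator μ (fun s => s.1) γ) (lmsEstimator μ (fun s => s.2.1) γ) =
      ((schurCov μ).toBlocks₁₁.trace - δ * (schurCov μ).toBlocks₂₂.trace + objective μ δ K :
        ℝ) := by
  have hx : 0 ≤ (errorCov μ K).toBlocks₁₁.trace := (h.posSemidef.submatrix Sum.inl).trace_nonneg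
  have hw : 0 ≤ (errorCov μ K).toBlocks₂₂.trace := (h.posSemidef.submatrix Sum.inr).trace_nonneg
  have hsub₁ : (errorCov μ K).toBlocks₁₁.trace =
    (schurCov μ).toBlocks₁₁.trace - (errorReduction μ K).toBlocks₁₁.trace := trace_sub _ _
  have hsub₂ : (errorCov μ K).toBlocks₂₂.trace =
    (schurCov μ).toBlocks₂₂.trace - (errorReduction μ K).toBlocks₂₂.trace := trace_sub _ _
  rw [senderCost, h.receiverCost_eq, h.maliciousCost_eq, EReal.coe_ennreal_ofReal,
    EReal.coe_ennreal_ofReal, max_eq_left hx, max_eq_left hw, ← EReal.coe_mul, ← EReal.coe_sub,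
    EReal.coe_eq_coe_iff, hsub₁, hsub₂, objective_eq]
  ring

end Program

section ProductMoments

open Matrix

variable {Ω Ω' ι κ : Type*} [MeasurableSpace Ω] [MeasurableSpace Ω'] {P : Measure Ω}
  {Q : Measure Ω'} [SFinite P]

lemma secondMoment_prod_fst [IsProbabilityMeasure Q] {a : Ω → ι → ℝ} {b : Ω → κ → ℝ} :
    secondMoment (P.prod Q) (fun p => a p.1) (fun p => b p.1) = secondMoment P a b := by
  ext i j
  simpa [secondMoment] using integral_fun_fst (μ := P) (ν := Q) fun ω => a ω i * b ω j

lemma secondMoment_prod_snd [IsProbabilityMeasure P] [SFinite Q] {a : Ω' → ι → ℝ}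
    {b : Ω' → κ → ℝ} :
    secondMoment (P.prod Q) (fun p => a p.2) (fun p => b p.2) = secondMoment Q a b := by
  ext i j
  simpa [secondMoment] using integral_fun_snd (μ := P) (ν := Q) fun ω => a ω i * b ω j

lemma secondMoment_prod_fst_snd [SFinite Q] {a : Ω → ι → ℝ} {b : Ω' → κ → ℝ}
    (hb : ∀ j, ∫ ω, b ω j ∂Q = 0) :
    secondMoment (P.prod Q) (fun p => a p.1) (fun p => b p.2) = 0 := by
  ext i j
  exact (integral_prod_mul (fun ω => a ω i) fun ω => b ω j).trans (by rw [hb, mul_zero]; rfl)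

lemma secondMoment_prod_snd_fst [SFinite Q] {a : Ω → ι → ℝ} {b : Ω' → κ → ℝ}
    (hb : ∀ j, ∫ ω, b ω j ∂Q = 0) :
    secondMoment (P.prod Q) (fun p => b p.2) (fun p => a p.1) = 0 := by
  rw [← secondMoment_transpose, secondMoment_prod_fst_snd hb, transpose_zero]

variable {ζ : Type*} [Fintype ζ] [DecidableEq ζ] {z : Ω → ζ → ℝ}

lemma partialCov_prod_fst [IsProbabilityMeasure Q] {a : Ω → ι → ℝ} {b : Ω → κ → ℝ} :
    partialCov (P.prod Q) (fun p => a p.1) (fun p => b p.1) (fun p => z p.1) =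
      partialCov P a b z := by
  simp only [partialCov, secondMoment_prod_fst]

lemma partialCov_prod_snd_fst [SFinite Q] {a : Ω → ι → ℝ} {b : Ω' → κ → ℝ}
    (hb : ∀ j, ∫ ω, b ω j ∂Q = 0) :
    partialCov (P.prod Q) (fun p => b p.2) (fun p => a p.1) (fun p => z p.1) = 0 := by
  rw [partialCov_eq_secondMoment (secondMoment_prod_snd_fst hb), secondMoment_prod_snd_fst hb]

lemma partialCov_prod_snd [IsProbabilityMeasure P] [SFinite Q] {a : Ω' → ι → ℝ}
    {b : Ω' → κ → ℝ} (ha : ∀ i, ∫ ω, a ω i ∂Q = 0) :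
    partialCov (P.prod Q) (fun p => a p.2) (fun p => b p.2) (fun p => z p.1) =
      secondMoment Q a b := by
  rw [partialCov_eq_secondMoment (secondMoment_prod_snd_fst ha), secondMoment_prod_snd]

end ProductMoments

section GaussianSender

open Matrix

variable {nx nw nz ny : ℕ} {μ : Measure (State nx nw nz)} {γ : Sender nx nw nz ny}
  {K : Matrix (Fin ny) (Fin nx ⊕ Fin nw) ℝ}

lemma isCenteredGaussian_multivariateGaussian (S : Matrix (Fin ny) (Fin ny) ℝ) :
    IsCenteredGaussian (multivariateGaussian (0 : Vec ny) S) :=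
  ⟨inferInstance, integral_id_multivariateGaussian⟩

lemma integral_multivariateGaussian_zero_apply (S : Matrix (Fin ny) (Fin ny) ℝ) (j : Fin ny) :
    ∫ v, v j ∂(multivariateGaussian (0 : Vec ny) S) = 0 :=
  (isCenteredGaussian_multivariateGaussian S).integral_of_isLinearMap
    ⟨fun _ _ => rfl, fun _ _ => rfl⟩

lemma secondMoment_multivariateGaussian {S : Matrix (Fin ny) (Fin ny) ℝ} (hS : S.PosSemidef) :
    secondMoment (multivariateGaussian (0 : Vec ny) S) (fun v => v.ofLp) (fun v => v.ofLp) = S := by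
  have hL2 (j : Fin ny) : MemLp (fun v : Vec ny => v j) 2 (multivariateGaussian 0 S) :=
    (isCenteredGaussian_multivariateGaussian S).memLp_two ⟨fun _ _ => rfl, fun _ _ => rfl⟩
  ext i j
  have hc := covariance_eval_multivariateGaussian (μ := (0 : Vec ny)) hS i j
  rwa [covariance_eq_sub (hL2 i) (hL2 j), integral_multivariateGaussian_zero_apply, zero_mul,
    sub_zero] at hc

/-- The law of the noise `v` that `gaussianSender μ K` adds to the message. -/
noncomputable def noiseLaw (μ : Measure (State nx nw nz))
    (K : Matrix (Fin ny) (Fin nx ⊕ Fin nw) ℝ) : Measure (Vec ny) :=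
  multivariateGaussian 0 (1 - K * schurCov μ * Kᵀ)

instance : IsProbabilityMeasure (noiseLaw μ K) := by
  unfold noiseLaw
  infer_instance

lemma integral_noiseLaw_apply (j : Fin ny) : ∫ v, v j ∂(noiseLaw μ K) = 0 :=
  integral_multivariateGaussian_zero_apply _ j

/-- The message `K_x x + K_w w + v` as a function of the state and the noise, paired with the
state. -/
noncomputable def stateMessage (K : Matrix (Fin ny) (Fin nx ⊕ Fin nw) ℝ)
    (p : State nx nw nz × Vec ny) : State nx nw nz × Vec ny :=
  (p.1, K.toCols₁.toEuclideanLin p.1.1 + K.toCols₂.toEuclideanLin p.1.2.1 + p.2)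

lemma stateMessage_snd (p : State nx nw nz × Vec ny) :
    (stateMessage K p).2.ofLp = K *ᵥ vecXW p.1 + p.2.ofLp := by
  conv_rhs => rw [← fromCols_toCols K, vecXW, fromCols_mulVec_sumElim]
  rfl

lemma isLinearMap_stateMessage :
    IsLinearMap ℝ (stateMessage K : State nx nw nz × Vec ny → _) where
  map_add p q := by
    refine Prod.ext rfl ?_
    simp only [stateMessage, Prod.fst_add, Prod.snd_add, map_add]
    abel
  map_smul c p := by
    refine Prod.ext rfl ?_
    simp only [stateMessage, Prod.smul_fst, Prod.smul_snd, map_smul, smul_add]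

lemma measurable_stateMessage : Measurable (stateMessage K : State nx nw nz × Vec ny → _) :=
  (continuous_of_isLinearMap isLinearMap_stateMessage).measurable

lemma lintegral_gaussianSender {f : Vec ny → ℝ≥0∞} (hf : Measurable f) (s : State nx nw nz) :
    ∫⁻ y, f y ∂(gaussianSender μ K).kernel s =
      ∫⁻ v, f (stateMessage K (s, v)).2 ∂(noiseLaw μ K) := by
  have hm : Measurable fun p : State nx nw nz × Vec ny => (stateMessage K p).2 :=
    measurable_snd.comp measurable_stateMessage
  exact (Kernel.lintegral_map _ hm _ hf).trans (Kernel.lintegral_id_prod (hf.comp hm) _ s)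

lemma jointLaw_gaussianSender [SFinite μ] :
    jointLaw μ (gaussianSender μ K) = (μ.prod (noiseLaw μ K)).map (stateMessage K) := by
  refine Measure.ext_of_lintegral _ fun f hf => ?_
  have hfm : Measurable fun p => f (stateMessage K p) := hf.comp measurable_stateMessage
  rw [jointLaw, Measure.lintegral_compProd hf, lintegral_map hf measurable_stateMessage,
    lintegral_prod _ hfm.aemeasurable]
  exact lintegral_congr fun s => lintegral_gaussianSender (by fun_prop) s

lemma isCenteredGaussian_prod_noiseLaw (hμ : IsCenteredGaussian μ) :
    IsCenteredGaussian (μ.prod (noiseLaw μ K)) :=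
  hμ.prod (isCenteredGaussian_multivariateGaussian _)

lemma memLp_prod_noiseLaw_snd (hμ : IsCenteredGaussian μ) :
    MemLp (fun p => p.2.ofLp) 2 (μ.prod (noiseLaw μ K)) :=
  (isCenteredGaussian_prod_noiseLaw hμ).memLp_two
    (isLinearMap_ofLp (LinearMap.snd ℝ (State nx nw nz) (Vec ny)).isLinear)

lemma isCenteredGaussian_jointLaw_gaussianSender (hμ : IsCenteredGaussian μ) :
    IsCenteredGaussian (jointLaw μ (gaussianSender μ K)) := by
  have := hμ.isGaussian
  rw [jointLaw_gaussianSender]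
  exact (isCenteredGaussian_prod_noiseLaw hμ).map isLinearMap_stateMessage

lemma isCenteredGaussian_jointLaw_scale [SFinite μ] (h : IsCenteredGaussian (jointLaw μ γ))
    (κ : Matrix (Fin ny) (Fin ny) ℝ) : IsCenteredGaussian (jointLaw μ (γ.scale κ)) := by
  rw [jointLaw_scale]
  exact h.map (isLinearMap_map_id_toEuclideanLin κ)

lemma partialCov_gain_add_noise_left {β : Type*} [Fintype β]
    {b : State nx nw nz × Vec ny → β → ℝ} (hμ : IsCenteredGaussian μ)
    (hb : MemLp b 2 (μ.prod (noiseLaw μ K))) :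
    partialCov (μ.prod (noiseLaw μ K)) (fun p => K *ᵥ vecXW p.1 + p.2.ofLp) b
        (fun p => vecZ p.1) =
      K * partialCov (μ.prod (noiseLaw μ K)) (fun p => vecXW p.1) b (fun p => vecZ p.1) +
        partialCov (μ.prod (noiseLaw μ K)) (fun p => p.2.ofLp) b (fun p => vecZ p.1) := by
  have hP := isCenteredGaussian_prod_noiseLaw (K := K) hμ
  have hs := hP.memLp_two (isLinearMap_comp_fst isLinearMap_vecXW)
  have hz := hP.memLp_two (isLinearMap_comp_fst isLinearMap_vecZ)
  rw [partialCov_add_left (memLp_mulVec K hs) (memLp_prod_noiseLaw_snd hμ) hb hz,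
    partialCov_mulVec_left K hs hb hz]

lemma partialCov_gain_add_noise_state (hμ : IsCenteredGaussian μ) :
    partialCov (μ.prod (noiseLaw μ K)) (fun p => K *ᵥ vecXW p.1 + p.2.ofLp)
      (fun p => vecXW p.1) (fun p => vecZ p.1) = K * schurCov μ := by
  have := hμ.isGaussian
  have hs := (isCenteredGaussian_prod_noiseLaw (K := K) hμ).memLp_two
    (isLinearMap_comp_fst isLinearMap_vecXW)
  rw [partialCov_gain_add_noise_left hμ hs, partialCov_prod_fst,
    partialCov_prod_snd_fst integral_noiseLaw_apply, add_zero]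
  rfl

lemma partialCov_gain_add_noise_noise (hμ : IsCenteredGaussian μ) (hK : K ∈ feasible μ ny) :
    partialCov (μ.prod (noiseLaw μ K)) (fun p => K *ᵥ vecXW p.1 + p.2.ofLp)
      (fun p => p.2.ofLp) (fun p => vecZ p.1) = 1 - K * schurCov μ * Kᵀ := by
  have := hμ.isGaussian
  rw [partialCov_gain_add_noise_left hμ (memLp_prod_noiseLaw_snd hμ),
    partialCov_prod_snd integral_noiseLaw_apply, ← partialCov_transpose,
    partialCov_prod_snd_fst integral_noiseLaw_apply, transpose_zero, Matrix.mul_zero, zero_add]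
  exact secondMoment_multivariateGaussian hK

lemma partialCov_gain_add_noise_self (hμ : IsCenteredGaussian μ) (hK : K ∈ feasible μ ny) :
    partialCov (μ.prod (noiseLaw μ K)) (fun p => K *ᵥ vecXW p.1 + p.2.ofLp)
      (fun p => K *ᵥ vecXW p.1 + p.2.ofLp) (fun p => vecZ p.1) = 1 := by
  have hs := (isCenteredGaussian_prod_noiseLaw (K := K) hμ).memLp_two
    (isLinearMap_comp_fst isLinearMap_vecXW)
  have hsymm : (1 - K * schurCov μ * Kᵀ)ᵀ = 1 - K * schurCov μ * Kᵀ := hK.isHermitian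
  have hy : MemLp (fun p : State nx nw nz × Vec ny => K *ᵥ vecXW p.1 + p.2.ofLp) 2
      (μ.prod (noiseLaw μ K)) := (memLp_mulVec K hs).add (memLp_prod_noiseLaw_snd hμ)
  have hstate : partialCov (μ.prod (noiseLaw μ K)) (fun p => vecXW p.1)
      (fun p => K *ᵥ vecXW p.1 + p.2.ofLp) (fun p => vecZ p.1) = (K * schurCov μ)ᵀ := by
    rw [← partialCov_transpose, partialCov_gain_add_noise_state hμ]
  have hnoise : partialCov (μ.prod (noiseLaw μ K)) (fun p => p.2.ofLp)
      (fun p => K *ᵥ vecXW p.1 + p.2.ofLp) (fun p => vecZ p.1) = 1 - K * schurCov μ * Kᵀ := by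
    rw [← partialCov_transpose, partialCov_gain_add_noise_noise hμ hK, hsymm]
  rw [partialCov_gain_add_noise_left hμ hy, hstate, hnoise, transpose_mul, schurCov_transpose,
    ← Matrix.mul_assoc, add_sub_cancel]

lemma messageCov_gaussianSender (hμ : IsCenteredGaussian μ) (hK : K ∈ feasible μ ny) :
    messageCov μ (gaussianSender μ K) = 1 := by
  have := hμ.isGaussian
  rw [messageCov, jointLaw_gaussianSender, partialCov_map measurable_stateMessage
    (by fun_prop) (by fun_prop) (by fun_prop)]
  simp only [stateMessage_snd]
  exact partialCov_gain_add_noise_self hμ hK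

lemma messageCrossCov_gaussianSender (hμ : IsCenteredGaussian μ) :
    messageCrossCov μ (gaussianSender μ K) = K * schurCov μ := by
  have := hμ.isGaussian
  rw [messageCrossCov, jointLaw_gaussianSender, partialCov_map measurable_stateMessage
    (by fun_prop) (by fun_prop) (by fun_prop)]
  simp only [stateMessage_snd]
  exact partialCov_gain_add_noise_state hμ

lemma isUnit_det_obsMoment_gaussianSender (hμ : IsCenteredGaussian μ)
    (hzz : IsUnit (secondMoment μ vecZ vecZ).det) (hK : K ∈ feasible μ ny) :
    IsUnit (obsMoment μ (gaussianSender μ K)).det := by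
  have := hμ.isGaussian
  have hM : IsUnit (messageCov μ (gaussianSender μ K)).det := by
    rw [messageCov_gaussianSender hμ hK, det_one]
    exact isUnit_one
  rw [← secondMoment_jointLaw_fst measurable_vecZ measurable_vecZ (γ := gaussianSender μ K)] at hzz
  exact isUnit_det_secondMoment_sumElim hzz hM

end GaussianSender

section ScaledSender

open Matrix

variable {nx nw nz ny : ℕ} {μ : Measure (State nx nw nz)} {γ : Sender nx nw nz ny}
  {K : Matrix (Fin ny) (Fin nx ⊕ Fin nw) ℝ} {κ : Matrix (Fin ny) (Fin ny) ℝ}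

lemma partialCov_jointLaw_scale [SFinite μ] {β : Type*} [Fintype β]
    {b : State nx nw nz × Vec ny → β → ℝ} (hJ : MemLp id 2 (jointLaw μ γ)) (hb : Measurable b)
    (hbκ : MemLp (fun p => b (Prod.map id κ.toEuclideanLin p)) 2 (jointLaw μ γ)) :
    partialCov (jointLaw μ (γ.scale κ)) (fun p => p.2) b (fun p => vecZ p.1) =
      κ * partialCov (jointLaw μ γ) (fun p => p.2)
        (fun p => b (Prod.map id κ.toEuclideanLin p)) (fun p => vecZ p.1) := by
  have hκ : Measurable (Prod.map id κ.toEuclideanLin : State nx nw nz × Vec ny → _) :=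
    (continuous_of_isLinearMap (isLinearMap_map_id_toEuclideanLin κ)).measurable
  rw [jointLaw_scale, partialCov_map hκ (by fun_prop) hb (by fun_prop)]
  exact partialCov_mulVec_left κ (memLp_snd hJ) hbκ (memLp_vecZ_fst hJ)

lemma messageCrossCov_scale [SFinite μ] (hJ : MemLp id 2 (jointLaw μ γ)) :
    messageCrossCov μ (γ.scale κ) = κ * messageCrossCov μ γ :=
  partialCov_jointLaw_scale hJ (by fun_prop) (memLp_vecXW_fst hJ)

lemma messageCov_scale [SFinite μ] (hJ : MemLp id 2 (jointLaw μ γ)) :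
    messageCov μ (γ.scale κ) = κ * messageCov μ γ * κᵀ := by
  have hκy : MemLp (fun p : State nx nw nz × Vec ny => κ *ᵥ p.2.ofLp) 2 (jointLaw μ γ) :=
    memLp_mulVec κ (memLp_snd hJ)
  have hcomm : partialCov (jointLaw μ γ) (fun p => p.2.ofLp) (fun p => κ *ᵥ p.2.ofLp)
      (fun p => vecZ p.1) = messageCov μ γ * κᵀ := by
    rw [← partialCov_transpose,
      partialCov_mulVec_left κ (memLp_snd hJ) (memLp_snd hJ) (memLp_vecZ_fst hJ), transpose_mul,
      partialCov_transpose]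
    rfl
  rw [messageCov, partialCov_jointLaw_scale hJ (by fun_prop) hκy, Matrix.mul_assoc, ← hcomm]
  rfl

lemma hasErrorCov_errorCov [IsProbabilityMeasure μ] (hJ : MemLp id 2 (jointLaw μ γ))
    (hzz : IsUnit (secondMoment μ vecZ vecZ).det) (hκ : κ.det ≠ 0)
    (hM : messageCov μ γ = κ * κᵀ) (hC : messageCrossCov μ γ = κ * (K * schurCov μ)) :
    HasErrorCov μ γ (errorCov μ K) := by
  have hκu : IsUnit κ.det := hκ.isUnit
  have hL : schurCov μ * Kᵀ * κ⁻¹ * messageCov μ γ = (messageCrossCov μ γ)ᵀ := by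
    rw [hM, hC, ← Matrix.mul_assoc, nonsing_inv_mul_cancel_right _ _ hκu, transpose_mul,
      transpose_mul, schurCov_transpose]
  convert hasErrorCov_of_mul_messageCov hJ hzz hL using 1
  rw [hL, hC, transpose_mul, transpose_mul, schurCov_transpose, transpose_mul, transpose_mul,
    schurCov_transpose, transpose_transpose, errorCov, errorReduction, ← Matrix.mul_assoc,
    Matrix.mul_assoc _ κᵀ, ← transpose_mul, nonsing_inv_mul _ hκu, transpose_one, Matrix.mul_one,
    Matrix.mul_assoc _ K]

lemma hasErrorCov_gaussianSender (hμ : IsCenteredGaussian μ)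
    (hzz : IsUnit (secondMoment μ vecZ vecZ).det) (hK : K ∈ feasible μ ny) :
    HasErrorCov μ (gaussianSender μ K) (errorCov μ K) := by
  have := hμ.isGaussian
  refine hasErrorCov_errorCov (κ := 1) (isCenteredGaussian_jointLaw_gaussianSender hμ).memLp_id
    hzz (by simp) ?_ ?_
  · rw [messageCov_gaussianSender hμ hK, transpose_one, Matrix.mul_one]
  · rw [messageCrossCov_gaussianSender hμ, Matrix.one_mul]

lemma hasErrorCov_gaussianSender_scale (hμ : IsCenteredGaussian μ)
    (hzz : IsUnit (secondMoment μ vecZ vecZ).det) (hK : K ∈ feasible μ ny) (hκ : κ.det ≠ 0) :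
    HasErrorCov μ ((gaussianSender μ K).scale κ) (errorCov μ K) := by
  have := hμ.isGaussian
  have hJ := isCenteredGaussian_jointLaw_gaussianSender (K := K) hμ
  refine hasErrorCov_errorCov (isCenteredGaussian_jointLaw_scale hJ κ).memLp_id hzz hκ ?_ ?_
  · rw [messageCov_scale hJ.memLp_id, messageCov_gaussianSender hμ hK, Matrix.mul_one]
  · rw [messageCrossCov_scale hJ.memLp_id, messageCrossCov_gaussianSender hμ]

end ScaledSender

section Equilibrium

open Matrix

variable {nx nw nz ny : ℕ} {μ : Measure (State nx nw nz)} {γ : Sender nx nw nz ny}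
  {K : Matrix (Fin ny) (Fin nx ⊕ Fin nw) ℝ} {δ : ℝ}

lemma gaussianSender_mem_withoutSideInformation :
    gaussianSender μ K ∈ withoutSideInformation nx nw nz ny := by
  have hx : Continuous K.toCols₁.toEuclideanLin := LinearMap.continuous_of_finiteDimensional _
  have hw : Continuous K.toCols₂.toEuclideanLin := LinearMap.continuous_of_finiteDimensional _
  have hmsg : Measurable fun p : (Vec nx × Vec nw) × Vec ny =>
      K.toCols₁.toEuclideanLin p.1.1 + K.toCols₂.toEuclideanLin p.1.2 + p.2 := by
    fun_prop
  refine ⟨⟨(Kernel.id ×ₖ Kernel.const _ (noiseLaw μ K)).map _,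
    Kernel.IsMarkovKernel.map _ hmsg⟩, fun x w z => Measure.ext_of_lintegral _ fun f hf => ?_⟩
  rw [lintegral_gaussianSender hf, Kernel.lintegral_map _ hmsg _ hf,
    Kernel.lintegral_id_prod (by fun_prop), Kernel.const_apply]
  rfl

lemma scale_mem_withoutSideInformation (h : γ ∈ withoutSideInformation nx nw nz ny)
    (κ : Matrix (Fin ny) (Fin ny) ℝ) : γ.scale κ ∈ withoutSideInformation nx nw nz ny := by
  have hκ : Measurable κ.toEuclideanLin :=
    (LinearMap.continuous_of_finiteDimensional _).measurable
  obtain ⟨γ₀, h₀⟩ := h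
  refine ⟨γ₀.scale κ, fun x w z => ?_⟩
  simp only [Policy.scale]
  rw [Kernel.map_apply _ hκ, Kernel.map_apply _ hκ, h₀]

lemma isEquilibrium_of_hasErrorCov {Γ : Set (Sender nx nw nz ny)} (hμ : IsCenteredGaussian μ)
    (hcov : (secondMoment μ vecXWZ vecXWZ).PosDef) (hK : K ∈ minimizers μ δ ny) (hγ : γ ∈ Γ)
    (hJ : IsCenteredGaussian (jointLaw μ γ)) (hE : HasErrorCov μ γ (errorCov μ K)) :
    IsEquilibrium μ δ Γ (lmsEstimator μ fun s => s.1) (lmsEstimator μ fun s => s.2.1) γ := by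
  have := hμ.isGaussian
  refine
    { mem := hγ
      receiverCost_ne_top := hE.receiverCost_eq.trans_ne ENNReal.ofReal_ne_top
      maliciousCost_ne_top := hE.maliciousCost_eq.trans_ne ENNReal.ofReal_ne_top
      receiver_optimal := fun _ => estimationCost_lmsEstimator_le hJ isLinearMap_stateX _
      malicious_optimal := fun _ => estimationCost_lmsEstimator_le hJ isLinearMap_stateW _
      sender_optimal := fun γ' _ => ?_ }
  obtain ⟨K', hK', hE'⟩ := exists_feasible_hasErrorCov hμ.memLp_id hcov γ'
  rw [hE.senderCost_eq, hE'.senderCost_eq, EReal.coe_le_coe_iff]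
  exact add_le_add_right (hK.2 K' hK') _

lemma minimizers_nonempty (hX : (schurCov μ).PosDef) (δ : ℝ) (ny : ℕ) :
    (minimizers μ δ ny).Nonempty := by
  obtain ⟨K, hK, hmin⟩ := exists_forall_trace_le (n := Fin ny) hX
    (schurCov μ * fromBlocks (-1) 0 0 (δ • 1) * schurCov μ)
  refine ⟨K, hK, fun K' hK' => ?_⟩
  simpa only [objective, Matrix.mul_assoc] using hmin K' hK'

end Equilibrium

section Informativeness

open Matrix

variable {nx nw nz ny : ℕ} {μ : Measure (State nx nw nz)}
  {K : Matrix (Fin ny) (Fin nx ⊕ Fin nw) ℝ} {δ : ℝ}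

lemma exists_feasible_objective_neg (hX : (schurCov μ).PosDef) (δ : ℝ) (hnx : 0 < nx)
    (hny : 0 < ny) : ∃ K ∈ feasible μ ny, objective μ δ K < 0 := by
  let i : Fin nx ⊕ Fin nw := .inl ⟨0, hnx⟩
  obtain ⟨K, hK, hKi⟩ := exists_gain_reduction_eq_single hX i (⟨0, hny⟩ : Fin ny)
  have hpos : 0 < ((schurCov μ)⁻¹ i i)⁻¹ := inv_pos.mpr hX.inv.diag_pos
  have hx : (errorReduction μ K).toBlocks₁₁.trace = ((schurCov μ)⁻¹ i i)⁻¹ := by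
    rw [errorReduction, hKi]
    simp [trace, toBlocks₁₁, i, single_apply]
  have hw : (errorReduction μ K).toBlocks₂₂.trace = 0 := by
    rw [errorReduction, hKi]
    simp [trace, toBlocks₂₂, i]
  refine ⟨K, hK, ?_⟩
  rw [objective_eq, hx, hw]
  linarith

lemma posSemidef_errorReduction : (errorReduction μ K).PosSemidef := by
  have h := posSemidef_conjTranspose_mul_self (K * schurCov μ)
  rwa [conjTranspose_eq_transpose_of_trivial, transpose_mul, schurCov_transpose,
    ← Matrix.mul_assoc] at h

lemma trace_errorReduction_pos_of_mem_minimizers (hX : (schurCov μ).PosDef) (hδ : 0 ≤ δ)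
    (hnx : 0 < nx) (hny : 0 < ny) (hK : K ∈ minimizers μ δ ny) :
    0 < (errorReduction μ K).toBlocks₁₁.trace := by
  obtain ⟨K', hK', hneg⟩ := exists_feasible_objective_neg hX δ hnx hny
  have hobj := (hK.2 K' hK').trans_lt hneg
  rw [objective_eq] at hobj
  have hw : 0 ≤ (errorReduction μ K).toBlocks₂₂.trace :=
    (posSemidef_errorReduction.submatrix Sum.inr).trace_nonneg
  exact (mul_nonneg hδ hw).trans_lt (sub_neg.mp hobj)

lemma trace_schurCov_le_of_estimator_sideInformation (hμ : IsCenteredGaussian μ)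
    (hzz : IsUnit (secondMoment μ vecZ vecZ).det) (η : Policy (Vec nz) (Vec nx)) :
    ENNReal.ofReal (schurCov μ).toBlocks₁₁.trace ≤
      ∫⁻ s, ∫⁻ e, ‖s.1 - e‖ₑ ^ 2 ∂(η.kernel s.2.2) ∂μ := by
  have := hμ.isGaussian
  have hE := hasErrorCov_gaussianSender hμ hzz (zero_mem_feasible (ny := 0))
  have hS : errorCov μ (0 : Matrix (Fin 0) (Fin nx ⊕ Fin nw) ℝ) = schurCov μ := by
    simp [errorCov, errorReduction]
  rw [← hS, ← hE.receiverCost_eq]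
  refine (estimationCost_lmsEstimator_le (isCenteredGaussian_jointLaw_gaussianSender hμ)
    isLinearMap_stateX ⟨η.kernel.comap Prod.snd measurable_snd, inferInstance⟩).trans_eq ?_
  simp [estimationCost]

lemma isInformative_of_mem_minimizers (hμ : IsCenteredGaussian μ)
    (hcov : (secondMoment μ vecXWZ vecXWZ).PosDef) (hδ : 0 ≤ δ) (hnx : 0 < nx) (hny : 0 < ny)
    (hK : K ∈ minimizers μ δ ny) :
    IsInformative μ (lmsEstimator μ fun s => s.1) (gaussianSender μ K) := by
  intro η
  have hzz := isUnit_det_of_posDef (posDef_secondMoment_vecZ hcov)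
  have hE := hasErrorCov_gaussianSender hμ hzz hK.1
  have hsub : (errorCov μ K).toBlocks₁₁.trace =
    (schurCov μ).toBlocks₁₁.trace - (errorReduction μ K).toBlocks₁₁.trace := trace_sub _ _
  have hlt : (errorCov μ K).toBlocks₁₁.trace < (schurCov μ).toBlocks₁₁.trace := by
    rw [hsub]
    exact sub_lt_self _
      (trace_errorReduction_pos_of_mem_minimizers (posDef_schurCov hcov) hδ hnx hny hK)
  refine lt_of_lt_of_le ?_ (trace_schurCov_le_of_estimator_sideInformation hμ hzz η)
  rw [hE.receiverCost_eq]
  exact (ENNReal.ofReal_lt_ofReal_iff_of_nonneg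
    (hE.posSemidef.submatrix Sum.inl).trace_nonneg).mpr hlt

end Informativeness

end PrivacyGame

theorem theorem3_general {nx nw nz ny : ℕ}
    (μ : Measure (State nx nw nz)) [IsGaussian μ]
    (hmean : ∫ s, s ∂μ = 0)
    (hcov : (secondMoment μ vecXWZ vecXWZ).PosDef)
    (δ : ℝ)
    (Γ : Set (Sender nx nw nz ny))
    (hΓ : withoutSideInformation nx nw nz ny ⊆ Γ) :
    (minimizers μ δ ny).Nonempty ∧
    ∃ (ψ : Sender nx nw nz ny → Estimator ny nz nx)
      (φ : Sender nx nw nz ny → Estimator ny nz nw),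
      (∀ γ, HasFiniteSecondMoment μ γ →
        IsLinearLMS μ (fun s => s.1) γ (ψ γ) ∧ IsLinearLMS μ (fun s => s.2.1) γ (φ γ)) ∧
      ∀ K ∈ minimizers μ δ ny,
        IsEquilibrium μ δ Γ ψ φ (gaussianSender μ K) ∧
        (0 ≤ δ → 0 < nx → 0 < ny → IsInformative μ ψ (gaussianSender μ K)) ∧
        HasFiniteSecondMoment μ (gaussianSender μ K) ∧
        IsUnit (obsMoment μ (gaussianSender μ K)).det ∧
        UsesGain μ (gaussianSender μ K) (ψ (gaussianSender μ K))
          (crossMoment μ (fun s => s.1) (gaussianSender μ K) *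
            (obsMoment μ (gaussianSender μ K))⁻¹) ∧
        UsesGain μ (gaussianSender μ K) (φ (gaussianSender μ K))
          (crossMoment μ (fun s => s.2.1) (gaussianSender μ K) *
            (obsMoment μ (gaussianSender μ K))⁻¹) ∧
        ∀ κ : Matrix (Fin ny) (Fin ny) ℝ, κ.det ≠ 0 →
          IsEquilibrium μ δ Γ ψ φ ((gaussianSender μ K).scale κ) := by
  have hμ : IsCenteredGaussian μ := ⟨inferInstance, hmean⟩
  have hzz := isUnit_det_of_posDef (posDef_secondMoment_vecZ hcov)
  have hLMS (γ : Sender nx nw nz ny) (hγ : HasFiniteSecondMoment μ γ) :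
      IsLinearLMS μ (fun s => s.1) γ (lmsEstimator μ (fun s => s.1) γ) ∧
        IsLinearLMS μ (fun s => s.2.1) γ (lmsEstimator μ (fun s => s.2.1) γ) :=
    ⟨isLinearLMS_lmsEstimator (hγ.memLp_id hμ.memLp_id) isLinearMap_stateX,
      isLinearLMS_lmsEstimator (hγ.memLp_id hμ.memLp_id) isLinearMap_stateW⟩
  refine ⟨minimizers_nonempty (posDef_schurCov hcov) δ ny, lmsEstimator μ fun s => s.1,
    lmsEstimator μ fun s => s.2.1, hLMS, fun K hK => ?_⟩
  have hJ := isCenteredGaussian_jointLaw_gaussianSender (K := K) hμ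
  have hmem := gaussianSender_mem_withoutSideInformation (μ := μ) (K := K)
  have hfin := hasFiniteSecondMoment_of_memLp_id hJ.memLp_id
  have hdet := isUnit_det_obsMoment_gaussianSender hμ hzz hK.1
  exact ⟨isEquilibrium_of_hasErrorCov hμ hcov hK (hΓ hmem) hJ
      (hasErrorCov_gaussianSender hμ hzz hK.1),
    fun hδ hnx hny => isInformative_of_mem_minimizers hμ hcov hδ hnx hny hK, hfin, hdet,
    (hLMS _ hfin).1.usesGain_crossMoment_mul_inv hdet,
    (hLMS _ hfin).2.usesGain_crossMoment_mul_inv hdet,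
    fun κ hκ => isEquilibrium_of_hasErrorCov hμ hcov hK
      (hΓ (scale_mem_withoutSideInformation hmem κ)) (isCenteredGaussian_jointLaw_scale hJ κ)
      (hasErrorCov_gaussianSender_scale hμ hzz hK.1 hκ)⟩

theorem theorem3 {nx nw nz ny : ℕ}
    (μ : Measure (State nx nw nz)) [IsGaussian μ]
    (hmean : ∫ s, s ∂μ = 0)
    (hcov : (secondMoment μ vecXWZ vecXWZ).PosDef)
    (δ : ℝ) (hδ : 0 ≤ δ)
    (Γ : Set (Sender nx nw nz ny))
    (hΓ : Γ = Set.univ ∨ Γ = withoutSideInformation nx nw nz ny) :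
    (minimizers μ δ ny).Nonempty ∧
    ∃ (ψ : Sender nx nw nz ny → Estimator ny nz nx)
      (φ : Sender nx nw nz ny → Estimator ny nz nw),
      (∀ γ ∈ Γ, HasFiniteSecondMoment μ γ →
        IsLinearLMS μ (fun s => s.1) γ (ψ γ) ∧ IsLinearLMS μ (fun s => s.2.1) γ (φ γ)) ∧
      ∀ K ∈ minimizers μ δ ny,
        IsEquilibrium μ δ Γ ψ φ (gaussianSender μ K) ∧
        (0 < nx → 0 < ny → IsInformative μ ψ (gaussianSender μ K)) ∧
        HasFiniteSecondMoment μ (gaussianSender μ K) ∧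
        IsUnit (obsMoment μ (gaussianSender μ K)).det ∧
        UsesGain μ (gaussianSender μ K) (ψ (gaussianSender μ K))
          (crossMoment μ (fun s => s.1) (gaussianSender μ K) *
            (obsMoment μ (gaussianSender μ K))⁻¹) ∧
        UsesGain μ (gaussianSender μ K) (φ (gaussianSender μ K))
          (crossMoment μ (fun s => s.2.1) (gaussianSender μ K) *
            (obsMoment μ (gaussianSender μ K))⁻¹) ∧
        ∀ κ : Matrix (Fin ny) (Fin ny) ℝ, κ.det ≠ 0 →
          IsEquilibrium μ δ Γ ψ φ ((gaussianSender μ K).scale κ) := by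
  have hsub : withoutSideInformation nx nw nz ny ⊆ Γ := by
    rcases hΓ with rfl | rfl
    exacts [Set.subset_univ _, subset_rfl]
  obtain ⟨hne, ψ, φ, hLMS, hmin⟩ := theorem3_general μ hmean hcov δ Γ hsub
  refine ⟨hne, ψ, φ, fun γ _ => hLMS γ, fun K hK => ?_⟩
  obtain ⟨heq, hinf, hrest⟩ := hmin K hK
  exact ⟨heq, hinf hδ, hrest⟩
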